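/- **Theorem 2.3 (Renormalization in Case 2).** Let $(X,\Sigma,\mu)$ be a $\sigma$-finite measure space, let $D,N\in\mathbb{N}_0$, let $\mathcal{F}=\bigoplus_{n\ge 0}S_nL^2(X)^{\otimes n}$ be the bosonic Fock space over $L^2(X)$ with vacuum $\Omega$, let $\mathfrak{H}=\mathbb{C}^D\otimes\mathcal{F}$, and write $\Psi^{(n)}$ for the $n$-boson component of $\Psi$. For $h\in L^2(X)$ let $a^*(h)$ and $a(h)$ be the creation and annihilation operators, $a^*(h)\psi=\sqrt{n+1}\,S_{n+1}(h\otimes\psi)$ on the $n$-boson sector and $a(h)$ its adjoint sector by sector, both on the domain $\operatorname{Dom}(\mathcal{N}^{1/2})=\{\Psi\in\mathfrak{H}:\sum_n n\Vert\Psi^{(n)}\Vert^2<\infty\}$. A matrix $M\in\mathbb{C}^{D\times D}$ acts on $\mathfrak{H}$ as $M\otimes 1$. Let $K=K^*\in\mathbb{C}^{D\times D}$, and let $B_1,\dots,B_N\in\mathbb{C}^{D\times D}$ satisfy $[B_j,B_{j'}]=0$ for all $j,j'$. Let $\omega:X\to\mathbb{R}$ be measurable with $\omega\ge m$ almost everywhere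 for some constant $m>0$, and let $f_1,\dots,f_N:X\to\mathbb{C}$ be measurable with $\omega^{-1}f_j\in L^2(X)$ for all $j$. Let $(e_\ell)_{\ell\in I}$ be an orthonormal basis of $L^2(X)$ contained in the domain $\operatorname{Dom}(\omega)=\{\phi\in L^2(X):\omega\phi\in L^2(X)\}$ of the multiplication operator $\omega$ (typically $I=\mathbb{N}$), and put $a^*_\ell=a^*(e_\ell)$ and $$\hat a_\ell=a(e_\ell)+\sum_{j=1}^N\Big\langle e_\ell,\frac{f_j}{\omega}\Big\rangle B_j .$$ Let $T=\exp(G)=\sum_{n\ge0}G^n/n!$ with $G=-\sum_{j=1}^NB_j\,a^*(f_j/\omega)$, where $(T\Psi)^{(m)}$ is the finite sum $\sum_{n\le m}\frac1{n!}(G^n\Psi)^{(m)}$ and $\operatorname{Dom}(T)=\{\Psi\in\mathfrak{H}:\sum_m\Vert(T\Psi)^{(m)}\Vert^2<\infty\}$. Then the following hold. 1. For all $v\in\mathbb{C}^D$, $n\in\mathbb{N}_0$ and $\ell_1,\dots,\ell_n\in I$, the dressed test vector $a^*_{\ell_1}\cdots a^*_{\ell_n}T(v\otimes\Omega)\in\mathfrak{H}$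 is well defined: $v\otimes\Omega\in\operatorname{Dom}(T)$, and each creation operator is applied to a vector of its domain. 2. The linear span $\mathcal{D}$ of all dressed test vectors is dense in $\mathfrak{H}$. 3. The linear operator $H:\mathcal{D}\to\mathfrak{H}$, $$H\Psi=\sum_{\ell,\ell'\in I}\langle e_\ell,\omega e_{\ell'}\rangle\,\hat a_\ell^*\hat a_{\ell'}\Psi+K\Psi ,$$ is well defined: for $\Psi\in\mathcal{D}$ every $\hat a_\ell^*\hat a_{\ell'}\Psi$ is defined, where $\hat a_\ell^*$ is the adjoint of $\hat a_\ell$, and the double series converges unconditionally in $\mathfrak{H}$. 4. $H$ is symmetric and bounded below: there is $c\in\mathbb{R}$ with $\langle\Psi,H\Psi\rangle\ge c\Vert\Psi\Vert^2$ for all $\Psi\in\mathcal{D}$. 5. The Friedrichs extension of $H$, that is, the restriction of the adjoint of $H$ to those vectors of its domain that lie in the domain of the closure of the quadratic form $\Psi\mapsto\langle\Psi,H\Psi\rangle$, is a self-adjoint extension of $H$ with the same lower bound $c$. -/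

import Mathlib

open MeasureTheory Filter Topology
open scoped ENNReal InnerProductSpace LinearPMap

noncomputable section

namespace GSB

section Sectors

variable {X : Type*} [MeasurableSpace X] (μ : Measure X) [SigmaFinite μ] (D : ℕ)

/-- `ℂ^D ⊗ L²(X)^{⊗ n}`, realised as the space of square integrable functions `X^n → ℂ^D`. -/
abbrev NBody (n : ℕ) : Type _ :=
  Lp (EuclideanSpace ℂ (Fin D)) 2 (Measure.pi (fun _ : Fin n => μ))

theorem measurePreserving_perm {n : ℕ} (σ : Equiv.Perm (Fin n)) :
    MeasurePreserving (fun k : Fin n → X => k ∘ σ)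
      (Measure.pi (fun _ : Fin n => μ)) (Measure.pi (fun _ : Fin n => μ)) := by
  have h := measurePreserving_piCongrLeft (fun _ : Fin n => μ) σ.symm
  convert h using 1
  funext k i
  have := Equiv.piCongrLeft_apply_apply (fun _ : Fin n => X) σ.symm k (σ i)
  rw [Equiv.symm_apply_apply] at this
  exact this.symm

/-- Permutation of the particles: `(U_σ ψ)(k) = ψ(k ∘ σ)`. -/
def permute {n : ℕ} (σ : Equiv.Perm (Fin n)) : NBody μ D n →ₗᵢ[ℂ] NBody μ D n :=
  Lp.compMeasurePreservingₗᵢ ℂ (fun k : Fin n → X => k ∘ σ) (measurePreserving_perm μ σ)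

theorem permute_permute {n : ℕ} (σ τ : Equiv.Perm (Fin n)) (ψ : NBody μ D n) :
    permute μ D σ (permute μ D τ ψ) = permute μ D (σ * τ) ψ :=
  (Lp.compMeasurePreserving_comp_apply ψ (measurePreserving_perm μ τ)
    (measurePreserving_perm μ σ)).symm

/-- The subspace of functions that are invariant under all permutations of the particles. -/
def symSubmodule (n : ℕ) : Submodule ℂ (NBody μ D n) where
  carrier := {ψ | ∀ σ : Equiv.Perm (Fin n), permute μ D σ ψ = ψ}
  zero_mem' σ := map_zero _
  add_mem' hψ hφ σ := by rw [map_add, hψ σ, hφ σ]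
  smul_mem' c ψ hψ σ := by rw [map_smul, hψ σ]

theorem isClosed_symSubmodule (n : ℕ) : IsClosed (symSubmodule μ D n : Set (NBody μ D n)) := by
  have : (symSubmodule μ D n : Set (NBody μ D n)) =
      ⋂ σ : Equiv.Perm (Fin n), {ψ | permute μ D σ ψ = ψ} := by
    ext ψ
    simp [symSubmodule]
  rw [this]
  exact isClosed_iInter fun σ => isClosed_eq (permute μ D σ).continuous continuous_id

/-- The `n`-boson sector `ℂ^D ⊗ S_n L²(X)^{⊗ n}`. -/
abbrev Sector (n : ℕ) : Type _ := symSubmodule μ D n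

instance (n : ℕ) : CompleteSpace (Sector μ D n) :=
  (isClosed_symSubmodule μ D n).completeSpace_coe

/-- The average over all permutations of the particles. -/
def average (n : ℕ) : NBody μ D n →L[ℂ] NBody μ D n :=
  ((n.factorial : ℂ)⁻¹) •
    ∑ σ : Equiv.Perm (Fin n), (permute μ D σ).toContinuousLinearMap

theorem average_mem (n : ℕ) (ψ : NBody μ D n) : average μ D n ψ ∈ symSubmodule μ D n := by
  intro τ
  simp only [average, smul_apply, sum_apply,
    LinearIsometry.coe_toContinuousLinearMap, map_smul, map_sum, permute_permute]
  congr 1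
  exact Fintype.sum_equiv (Equiv.mulLeft τ) _ _ fun σ => rfl

theorem norm_average_le (n : ℕ) (ψ : NBody μ D n) : ‖average μ D n ψ‖ ≤ ‖ψ‖ := by
  have hn : (0 : ℝ) < n.factorial := by exact_mod_cast n.factorial_pos
  simp only [average, smul_apply, sum_apply,
    LinearIsometry.coe_toContinuousLinearMap]
  rw [norm_smul, norm_inv, Complex.norm_natCast, inv_mul_le_iff₀ hn]
  refine (norm_sum_le _ _).trans ?_
  simp [Fintype.card_perm]

/-- The symmetrization operator `S_n`, with values in the `n`-boson sector. -/
def symmetrize (n : ℕ) : NBody μ D n →L[ℂ] Sector μ D n :=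
  (average μ D n).codRestrict (symSubmodule μ D n) (average_mem μ D n)

variable {μ D}

theorem memLp_tensor (f : Lp ℂ 2 μ) {n : ℕ} (ψ : NBody μ D n) :
    MemLp (fun k : Fin (n + 1) → X => f (k 0) • ψ (Fin.tail k)) 2
      (Measure.pi (fun _ : Fin (n + 1) => μ)) := by
  have h : MemLp (fun p : X × (Fin n → X) => f p.1 • ψ p.2) 2
      (μ.prod (Measure.pi (fun _ : Fin n => μ))) := by
    have hm : AEStronglyMeasurable (fun p : X × (Fin n → X) => f p.1 • ψ p.2)
        (μ.prod (Measure.pi (fun _ : Fin n => μ))) :=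
      (Lp.aestronglyMeasurable f).comp_fst.smul (Lp.aestronglyMeasurable ψ).comp_snd
    rw [memLp_two_iff_integrable_sq_norm hm]
    simp only [norm_smul, mul_pow]
    exact ((memLp_two_iff_integrable_sq_norm (Lp.aestronglyMeasurable f)).1 (Lp.memLp f)).mul_prod
      ((memLp_two_iff_integrable_sq_norm (Lp.aestronglyMeasurable ψ)).1 (Lp.memLp ψ))
  exact h.comp_measurePreserving (measurePreserving_piFinSuccAbove (fun _ : Fin (n + 1) => μ) 0)

/-- The tensor product `f ⊗ ψ`, that is `(f ⊗ ψ)(k₀, …, kₙ) = f(k₀) ψ(k₁, …, kₙ)`. -/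
def tensor (f : Lp ℂ 2 μ) {n : ℕ} (ψ : NBody μ D n) : NBody μ D (n + 1) :=
  (memLp_tensor f ψ).toLp _

theorem ae_tail {n : ℕ} {p : (Fin n → X) → Prop}
    (h : ∀ᵐ k ∂(Measure.pi (fun _ : Fin n => μ)), p k) :
    ∀ᵐ k ∂(Measure.pi (fun _ : Fin (n + 1) => μ)), p (Fin.tail k) := by
  have h1 := (measurePreserving_piFinSuccAbove
    (fun _ : Fin (n + 1) => μ) 0).quasiMeasurePreserving
  exact (Measure.quasiMeasurePreserving_snd.comp h1).ae h

theorem norm_sq_L2 {α : Type*} [MeasurableSpace α] {ν : Measure α} {G : Type*}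
    [NormedAddCommGroup G] [InnerProductSpace ℂ G] (φ : Lp G 2 ν) :
    ‖φ‖ ^ 2 = ∫ x, ‖φ x‖ ^ 2 ∂ν := by
  rw [← inner_self_eq_norm_sq (𝕜 := ℂ) φ, L2.inner_def, ← integral_re (L2.integrable_inner φ φ)]
  exact integral_congr_ae (Eventually.of_forall fun x => inner_self_eq_norm_sq (𝕜 := ℂ) (φ x))

theorem norm_tensor (f : Lp ℂ 2 μ) {n : ℕ} (ψ : NBody μ D n) :
    ‖tensor f ψ‖ = ‖f‖ * ‖ψ‖ := by
  have h : ‖tensor f ψ‖ ^ 2 = (‖f‖ * ‖ψ‖) ^ 2 := by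
    rw [mul_pow, norm_sq_L2, norm_sq_L2, norm_sq_L2, ← integral_prod_mul]
    rw [← (measurePreserving_piFinSuccAbove (fun _ : Fin (n + 1) => μ) 0).integral_comp']
    refine integral_congr_ae ?_
    filter_upwards [(memLp_tensor f ψ).coeFn_toLp] with k hk
    rw [tensor, hk, norm_smul, mul_pow]
    rfl
  exact (pow_left_inj₀ (norm_nonneg _) (by positivity) two_ne_zero).1 h

variable (D) in
/-- The operator `ψ ↦ f ⊗ ψ`. -/
def tensorL (f : Lp ℂ 2 μ) (n : ℕ) : NBody μ D n →L[ℂ] NBody μ D (n + 1) :=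
  LinearMap.mkContinuous
    { toFun := tensor f
      map_add' := fun ψ φ => by
        refine Lp.ext ?_
        filter_upwards [(memLp_tensor f (ψ + φ)).coeFn_toLp, (memLp_tensor f ψ).coeFn_toLp,
          (memLp_tensor f φ).coeFn_toLp, ae_tail (Lp.coeFn_add ψ φ),
          Lp.coeFn_add (tensor f ψ) (tensor f φ)] with k h1 h2 h3 h4 h5
        rw [h5, Pi.add_apply]
        simp only [tensor]
        rw [h1, h2, h3, h4, Pi.add_apply, smul_add]
      map_smul' := fun c ψ => by
        refine Lp.ext ?_
        filter_upwards [(memLp_tensor f (c • ψ)).coeFn_toLp, (memLp_tensor f ψ).coeFn_toLp,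
          ae_tail (Lp.coeFn_smul c ψ), Lp.coeFn_smul c (tensor f ψ)] with k h1 h2 h3 h4
        rw [RingHom.id_apply, h4, Pi.smul_apply]
        simp only [tensor]
        rw [h1, h2, h3, Pi.smul_apply, smul_comm] }
    ‖f‖ fun ψ => (norm_tensor f ψ).le

variable (D) in
/-- The creation operator between sectors: `a*(f) ψ = √(n+1) S_{n+1} (f ⊗ ψ)`. -/
def createSector (f : Lp ℂ 2 μ) (n : ℕ) : Sector μ D n →L[ℂ] Sector μ D (n + 1) :=
  ((Real.sqrt (n + 1) : ℝ) : ℂ) •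
    (symmetrize μ D (n + 1) ∘L tensorL D f n ∘L (symSubmodule μ D n).subtypeL)

variable (D) in
/-- The annihilation operator between sectors, the adjoint of the creation operator. -/
def annihilateSector (f : Lp ℂ 2 μ) (n : ℕ) : Sector μ D (n + 1) →L[ℂ] Sector μ D n :=
  ContinuousLinearMap.adjoint (createSector D f n)

theorem norm_createSector_le (f : Lp ℂ 2 μ) (n : ℕ) :
    ‖createSector D f n‖ ≤ Real.sqrt (n + 1) * ‖f‖ := by
  refine ContinuousLinearMap.opNorm_le_bound _ (by positivity) fun ψ => ?_
  have h1 : ‖symmetrize μ D (n + 1) (tensorL D f n (ψ : NBody μ D n))‖ ≤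
      ‖tensorL D f n (ψ : NBody μ D n)‖ := norm_average_le μ D (n + 1) _
  have h2 : ‖tensorL D f n (ψ : NBody μ D n)‖ = ‖f‖ * ‖ψ‖ := norm_tensor f _
  change ‖((Real.sqrt (n + 1) : ℝ) : ℂ) •
    symmetrize μ D (n + 1) (tensorL D f n (ψ : NBody μ D n))‖ ≤ _
  rw [norm_smul, Complex.norm_real, Real.norm_of_nonneg (Real.sqrt_nonneg _), mul_assoc]
  gcongr
  exact h1.trans h2.le

theorem norm_annihilateSector_le (f : Lp ℂ 2 μ) (n : ℕ) :
    ‖annihilateSector D f n‖ ≤ Real.sqrt (n + 1) * ‖f‖ := by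
  rw [annihilateSector, LinearIsometryEquiv.norm_map]
  exact norm_createSector_le f n

variable (μ) in
/-- The action `M ⊗ 1` of a `D × D` matrix on `ℂ^D ⊗ L²(X)^{⊗ n}`. -/
def spinNBody (M : Matrix (Fin D) (Fin D) ℂ) (n : ℕ) : NBody μ D n →L[ℂ] NBody μ D n :=
  (Matrix.toEuclideanCLM (n := Fin D) (𝕜 := ℂ) M).compLpL 2 (Measure.pi (fun _ : Fin n => μ))

theorem spinNBody_mem (M : Matrix (Fin D) (Fin D) ℂ) (n : ℕ) (ψ : Sector μ D n) :
    spinNBody μ M n ψ ∈ symSubmodule μ D n := by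
  intro σ
  have hσ := measurePreserving_perm μ σ
  have h0 := ψ.2 σ
  conv_rhs => rw [← h0]
  refine Lp.ext ?_
  set L := Matrix.toEuclideanCLM (n := Fin D) (𝕜 := ℂ) M
  have e1 := Lp.coeFn_compMeasurePreserving (spinNBody μ M n ψ) hσ
  have e2 := hσ.quasiMeasurePreserving.ae (L.coeFn_compLpL (p := 2) (ψ : NBody μ D n))
  have e3 := L.coeFn_compLpL (p := 2) (permute μ D σ (ψ : NBody μ D n))
  have e4 := Lp.coeFn_compMeasurePreserving (ψ : NBody μ D n) hσ
  filter_upwards [e1, e2, e3, e4] with k h1 h2 h3 h4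
  exact h1.trans (h2.trans ((congrArg L h4.symm).trans h3.symm))

variable (μ) in
/-- The action `M ⊗ 1` of a `D × D` matrix on the `n`-boson sector. -/
def spinSector (M : Matrix (Fin D) (Fin D) ℂ) (n : ℕ) : Sector μ D n →L[ℂ] Sector μ D n :=
  (spinNBody μ M n ∘L (symSubmodule μ D n).subtypeL).codRestrict (symSubmodule μ D n)
    (spinNBody_mem M n)

theorem norm_spinSector_le (M : Matrix (Fin D) (Fin D) ℂ) (n : ℕ) :
    ‖spinSector μ M n‖ ≤ ‖Matrix.toEuclideanCLM (n := Fin D) (𝕜 := ℂ) M‖ :=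
  ContinuousLinearMap.opNorm_le_bound _ (norm_nonneg _) fun ψ =>
    ContinuousLinearMap.norm_compLp_le _ (ψ : NBody μ D n)

end Sectors

section Fock

variable {X : Type*} [MeasurableSpace X] (μ : Measure X) [SigmaFinite μ] (D : ℕ)

/-- Arbitrary sequences of `n`-boson components. -/
abbrev FormalFock : Type _ := ∀ n : ℕ, Sector μ D n

/-- The Hilbert space `ℂ^D ⊗ 𝓕`, with `𝓕 = ⨁ₙ S_n L²(X)^{⊗ n}` the bosonic Fock space. -/
abbrev Fock : Type _ := lp (fun n : ℕ => Sector μ D n) 2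

variable {D} in
/-- The vector `v ⊗ Ω`, with `Ω` the vacuum. -/
def vacuum (v : EuclideanSpace ℂ (Fin D)) : Fock μ D :=
  lp.single 2 0
    (⟨indicatorConstLp 2 MeasurableSet.univ (by simp) v, fun σ => by
      rw [Subsingleton.elim σ 1]
      exact Lp.compMeasurePreserving_id_apply _⟩ : Sector μ D 0)

/-- The form domain of the number operator: `Ψ` with `∑ₙ n ‖Ψ⁽ⁿ⁾‖² < ∞`. This is the domain
of the square root of the number operator. -/
def numberHalfDomain : Submodule ℂ (Fock μ D) where
  carrier := {Ψ | Summable fun n : ℕ => (n : ℝ) * ‖Ψ n‖ ^ 2}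
  zero_mem' := by simp
  add_mem' {Ψ Φ} hΨ hΦ := by
    refine Summable.of_nonneg_of_le (fun n => by positivity) (fun n => ?_)
      ((hΨ.mul_left 2).add (hΦ.mul_left 2))
    have h1 : ‖(Ψ + Φ) n‖ ≤ ‖Ψ n‖ + ‖Φ n‖ := norm_add_le _ _
    have h2 : ‖(Ψ + Φ) n‖ ^ 2 ≤ 2 * ‖Ψ n‖ ^ 2 + 2 * ‖Φ n‖ ^ 2 := by
      nlinarith [norm_nonneg ((Ψ + Φ) n), sq_nonneg (‖Ψ n‖ - ‖Φ n‖)]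
    nlinarith [mul_le_mul_of_nonneg_left h2 (Nat.cast_nonneg (α := ℝ) n)]
  smul_mem' c Ψ hΨ := by
    refine (hΨ.mul_left (‖c‖ ^ 2)).congr fun n => ?_
    have : ‖(c • Ψ) n‖ = ‖c‖ * ‖Ψ n‖ := norm_smul c (Ψ n)
    rw [this]
    ring

variable {μ D}

/-- The operator on a given domain acting as a given operator on sequences of components. -/
def ofFormal (A : FormalFock μ D →ₗ[ℂ] FormalFock μ D) (V : Submodule ℂ (Fock μ D))
    (h : ∀ Ψ ∈ V, Memℓp (A (fun n => Ψ n)) 2) : Fock μ D →ₗ.[ℂ] Fock μ D where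
  domain := V
  toFun :=
    { toFun := fun Ψ => ⟨A (fun n => (Ψ : Fock μ D) n), h Ψ Ψ.2⟩
      map_add' := fun Ψ _ => Subtype.ext (map_add A (fun n => (Ψ : Fock μ D) n) _)
      map_smul' := fun c Ψ => Subtype.ext (map_smul A c (fun n => (Ψ : Fock μ D) n)) }

/-- The domain of all `Ψ` for which the sequence `A Ψ` is square summable. -/
def maximalDomain (A : FormalFock μ D →ₗ[ℂ] FormalFock μ D) : Submodule ℂ (Fock μ D) where
  carrier := {Ψ | Memℓp (A (fun n => Ψ n)) 2}
  zero_mem' := by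
    have : A (fun n => (0 : Fock μ D) n) = 0 := map_zero A
    simpa only [Set.mem_ofPred_eq, this] using zero_memℓp
  add_mem' {Ψ Φ} hΨ hΦ := by
    have : A (fun n => (Ψ + Φ) n) = A (fun n => Ψ n) + A (fun n => Φ n) :=
      map_add A (fun n => Ψ n) _
    simpa only [Set.mem_ofPred_eq, this] using Memℓp.add hΨ hΦ
  smul_mem' c Ψ hΨ := by
    have : A (fun n => (c • Ψ) n) = c • A (fun n => Ψ n) := map_smul A c (fun n => Ψ n)
    simpa only [Set.mem_ofPred_eq, this] using Memℓp.const_smul hΨ c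

variable (D) in
/-- `(a*(f) Ψ)⁽⁰⁾ = 0` and `(a*(f) Ψ)⁽ⁿ⁺¹⁾ = a*(f) Ψ⁽ⁿ⁾`. -/
def createFormal (f : Lp ℂ 2 μ) : FormalFock μ D →ₗ[ℂ] FormalFock μ D :=
  LinearMap.pi fun n =>
    match n with
    | 0 => 0
    | n + 1 => (createSector D f n).toLinearMap ∘ₗ LinearMap.proj n

variable (D) in
/-- `(a(f) Ψ)⁽ⁿ⁾ = a(f) Ψ⁽ⁿ⁺¹⁾`. -/
def annihilateFormal (f : Lp ℂ 2 μ) : FormalFock μ D →ₗ[ℂ] FormalFock μ D :=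
  LinearMap.pi fun n => (annihilateSector D f n).toLinearMap ∘ₗ LinearMap.proj (n + 1)

variable (μ) in
/-- `((M ⊗ 1) Ψ)⁽ⁿ⁾ = (M ⊗ 1) Ψ⁽ⁿ⁾`. -/
def spinFormal (M : Matrix (Fin D) (Fin D) ℂ) : FormalFock μ D →ₗ[ℂ] FormalFock μ D :=
  LinearMap.pi fun n => (spinSector μ M n).toLinearMap ∘ₗ LinearMap.proj n

theorem summable_sq (Ψ : Fock μ D) : Summable fun n => ‖Ψ n‖ ^ 2 := by
  simpa using (lp.memℓp Ψ).summable (by norm_num)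

theorem memℓp_two {Ψ : FormalFock μ D} (h : Summable fun n => ‖Ψ n‖ ^ 2) : Memℓp Ψ 2 :=
  memℓp_gen (by simpa using h)

theorem memℓp_create (f : Lp ℂ 2 μ) (Ψ : Fock μ D) (hΨ : Ψ ∈ numberHalfDomain μ D) :
    Memℓp (createFormal D f (fun n => Ψ n)) 2 := by
  refine memℓp_two ((summable_nat_add_iff 1).1 ?_)
  refine Summable.of_nonneg_of_le (fun n => by positivity) (fun n => ?_)
    ((hΨ.add (summable_sq Ψ)).mul_left (‖f‖ ^ 2))
  have h : ‖createSector D f n (Ψ n)‖ ≤ Real.sqrt (n + 1) * ‖f‖ * ‖Ψ n‖ :=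
    (createSector D f n).le_of_opNorm_le (norm_createSector_le f n) _
  change ‖createSector D f n (Ψ n)‖ ^ 2 ≤ _
  calc _ ≤ (Real.sqrt (n + 1) * ‖f‖ * ‖Ψ n‖) ^ 2 := by gcongr
    _ = _ := by
      rw [mul_pow, mul_pow, Real.sq_sqrt (by positivity)]
      ring

theorem memℓp_annihilate (f : Lp ℂ 2 μ) (Ψ : Fock μ D) (hΨ : Ψ ∈ numberHalfDomain μ D) :
    Memℓp (annihilateFormal D f (fun n => Ψ n)) 2 := by
  refine memℓp_two ?_
  refine Summable.of_nonneg_of_le (fun n => by positivity) (fun n => ?_)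
    (((summable_nat_add_iff 1).2 hΨ).mul_left (‖f‖ ^ 2))
  have h : ‖annihilateSector D f n (Ψ (n + 1))‖ ≤ Real.sqrt (n + 1) * ‖f‖ * ‖Ψ (n + 1)‖ :=
    (annihilateSector D f n).le_of_opNorm_le (norm_annihilateSector_le f n) _
  change ‖annihilateSector D f n (Ψ (n + 1))‖ ^ 2 ≤ _
  calc _ ≤ (Real.sqrt (n + 1) * ‖f‖ * ‖Ψ (n + 1)‖) ^ 2 := by gcongr
    _ = _ := by
      rw [mul_pow, mul_pow, Real.sq_sqrt (by positivity)]
      push_cast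
      ring

variable (D) in
/-- The creation operator `a*(f)` on the domain of the square root of the number operator. -/
def creation (f : Lp ℂ 2 μ) : Fock μ D →ₗ.[ℂ] Fock μ D :=
  ofFormal (createFormal D f) (numberHalfDomain μ D) (memℓp_create f)

variable (D) in
/-- The annihilation operator `a(f)` on the domain of the square root of the number operator. -/
def annihilation (f : Lp ℂ 2 μ) : Fock μ D →ₗ.[ℂ] Fock μ D :=
  ofFormal (annihilateFormal D f) (numberHalfDomain μ D) (memℓp_annihilate f)

variable (μ) in
/-- The bounded operator `M ⊗ 1` on `ℂ^D ⊗ 𝓕`. -/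
def spin (M : Matrix (Fin D) (Fin D) ℂ) : Fock μ D →L[ℂ] Fock μ D :=
  lp.mapCLM 2 (spinSector μ M) (norm_nonneg _) (norm_spinSector_le M)

end Fock

section Model

variable {X : Type*} [MeasurableSpace X] {μ : Measure X}

variable (μ) in
/-- The domain of the operator of multiplication by `ω` on `L²(X)`: all `φ` with `ω φ ∈ L²(X)`. -/
def mulDomain (ω : X → ℝ) : Submodule ℂ (Lp ℂ 2 μ) where
  carrier := {φ | MemLp (fun x => (ω x : ℂ) * φ x) 2 μ}
  zero_mem' := by
    refine (memLp_congr_ae ?_).2 (MemLp.zero (ε := ℂ))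
    filter_upwards [Lp.coeFn_zero ℂ 2 μ] with x hx
    rw [hx, Pi.zero_apply, mul_zero]
  add_mem' := fun {φ χ} hφ hχ => by
    refine (memLp_congr_ae ?_).2 (MemLp.add hφ hχ)
    filter_upwards [Lp.coeFn_add φ χ] with x hx
    rw [hx, Pi.add_apply, mul_add, Pi.add_apply]
  smul_mem' := fun c φ hφ => by
    refine (memLp_congr_ae ?_).2 (MemLp.const_smul hφ c)
    filter_upwards [Lp.coeFn_smul c φ] with x hx
    rw [hx, Pi.smul_apply, Pi.smul_apply, smul_eq_mul, smul_eq_mul, mul_left_comm]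

theorem memLp_mul {ω : X → ℝ} (φ : mulDomain μ ω) :
    MemLp (fun x => (ω x : ℂ) * (φ : Lp ℂ 2 μ) x) 2 μ := φ.2

variable (μ) in
/-- The operator of multiplication by a real function on `L²(X)`, on its maximal domain. -/
def mulOp (ω : X → ℝ) : Lp ℂ 2 μ →ₗ.[ℂ] Lp ℂ 2 μ where
  domain := mulDomain μ ω
  toFun :=
    { toFun := fun φ => (memLp_mul φ).toLp
      map_add' := fun φ χ => by
        rw [← MemLp.toLp_add]
        refine MemLp.toLp_congr _ _ ?_
        filter_upwards [Lp.coeFn_add (φ : Lp ℂ 2 μ) χ] with x hx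
        rw [Submodule.coe_add, hx, Pi.add_apply, mul_add, Pi.add_apply]
      map_smul' := fun c φ => by
        rw [RingHom.id_apply, ← MemLp.toLp_const_smul]
        refine MemLp.toLp_congr _ _ ?_
        filter_upwards [Lp.coeFn_smul c (φ : Lp ℂ 2 μ)] with x hx
        rw [Submodule.coe_smul, hx, Pi.smul_apply, Pi.smul_apply, smul_eq_mul, smul_eq_mul,
          mul_left_comm] }

variable {D N : ℕ}

/-- The functions `f_j / ω` as elements of `L²(X)`. Below they are denoted by `g j`. -/
def ratio {f : Fin N → X → ℂ} {ω : X → ℝ}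
    (h : ∀ j, MemLp (fun x => f j x / (ω x : ℂ)) 2 μ) : Fin N → Lp ℂ 2 μ :=
  fun j => (h j).toLp

variable [SigmaFinite μ]

/-- The operator `-∑ⱼ Bⱼ a*(gⱼ)` on sequences of components. -/
def dressingGenerator (B : Fin N → Matrix (Fin D) (Fin D) ℂ) (g : Fin N → Lp ℂ 2 μ) :
    FormalFock μ D →ₗ[ℂ] FormalFock μ D :=
  -∑ j, spinFormal μ (B j) ∘ₗ createFormal D (g j)

/-- `∑ₙ (1/n!) Gⁿ` on sequences of components, with `G = -∑ⱼ Bⱼ a*(gⱼ)`. As `G` creates exactly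
one boson, only the terms with `n ≤ m` contribute to the `m`-boson component. -/
def dressingFormal (B : Fin N → Matrix (Fin D) (Fin D) ℂ) (g : Fin N → Lp ℂ 2 μ) :
    FormalFock μ D →ₗ[ℂ] FormalFock μ D :=
  LinearMap.pi fun m => ∑ n ∈ Finset.range (m + 1),
    ((n.factorial : ℂ)⁻¹) • (LinearMap.proj m ∘ₗ (dressingGenerator B g ^ n))

theorem dressingGenerator_pow_apply_eq_zero (B : Fin N → Matrix (Fin D) (Fin D) ℂ)
    (g : Fin N → Lp ℂ 2 μ) (Ψ : FormalFock μ D) :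
    ∀ n m : ℕ, m < n → (dressingGenerator B g ^ n) Ψ m = 0 := by
  intro n
  induction n with
  | zero => intro m hm; omega
  | succ n ih =>
    intro m hm
    rw [pow_succ', Module.End.mul_apply]
    cases m with
    | zero => simp [dressingGenerator, spinFormal, createFormal]
    | succ m =>
      have := ih m (by omega)
      simp [dressingGenerator, spinFormal, createFormal] at this ⊢
      simp [this]

theorem hasSum_dressingFormal (B : Fin N → Matrix (Fin D) (Fin D) ℂ) (g : Fin N → Lp ℂ 2 μ)
    (Ψ : FormalFock μ D) (m : ℕ) :
    HasSum (fun n : ℕ => ((n.factorial : ℂ)⁻¹) • (dressingGenerator B g ^ n) Ψ m)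
      (dressingFormal B g Ψ m) := by
  have h : dressingFormal B g Ψ m = ∑ n ∈ Finset.range (m + 1),
      ((n.factorial : ℂ)⁻¹) • (dressingGenerator B g ^ n) Ψ m := by
    simp [dressingFormal]
  rw [h]
  refine hasSum_sum_of_ne_finset_zero fun n hn => ?_
  rw [dressingGenerator_pow_apply_eq_zero B g Ψ n m (by simpa using hn), smul_zero]

/-- The dressing operator `T = exp(-∑ⱼ Bⱼ a*(gⱼ))` on its maximal domain. -/
def dressing (B : Fin N → Matrix (Fin D) (Fin D) ℂ) (g : Fin N → Lp ℂ 2 μ) :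
    Fock μ D →ₗ.[ℂ] Fock μ D :=
  ofFormal (dressingFormal B g) (maximalDomain (dressingFormal B g)) fun _ h => h

/-- The displaced annihilation operator `â(h) = a(h) + ∑ⱼ ⟨h, gⱼ⟩ Bⱼ`. -/
def displaced (B : Fin N → Matrix (Fin D) (Fin D) ℂ) (g : Fin N → Lp ℂ 2 μ) (h : Lp ℂ 2 μ) :
    Fock μ D →ₗ.[ℂ] Fock μ D :=
  (∑ j, ⟪h, g j⟫_ℂ • (spin μ (B j)).toLinearMap) +ᵥ annihilation D h

variable {ι : Type*}

/-- `IsDressed B g e v [ℓ₁, …, ℓₙ] Ψ` says that `a*(e_ℓ₁) ⋯ a*(e_ℓₙ) T (v ⊗ Ω)` is defined, every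
operator being applied to a vector of its domain, and is equal to `Ψ`. -/
def IsDressed (B : Fin N → Matrix (Fin D) (Fin D) ℂ) (g : Fin N → Lp ℂ 2 μ) (e : ι → Lp ℂ 2 μ)
    (v : EuclideanSpace ℂ (Fin D)) : List ι → Fock μ D → Prop
  | [], Ψ => (vacuum μ v, Ψ) ∈ (dressing B g).graph
  | l :: ls, Ψ => ∃ Φ, IsDressed B g e v ls Φ ∧ (Φ, Ψ) ∈ (creation D (e l)).graph

/-- The span of the dressed test vectors. -/
def testDomain (B : Fin N → Matrix (Fin D) (Fin D) ℂ) (g : Fin N → Lp ℂ 2 μ)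
    (e : ι → Lp ℂ 2 μ) : Submodule ℂ (Fock μ D) :=
  Submodule.span ℂ {Ψ | ∃ v ls, IsDressed B g e v ls Ψ}

/-- `∑_{ℓ,ℓ'} ⟨e_ℓ, ω e_ℓ'⟩ â_ℓ* â_ℓ' Ψ + K Ψ` is defined and equal to `Φ`: the vector `Ψ` lies in
the domain of every `â_ℓ'`, every `â_ℓ' Ψ` in the domain of every adjoint `â_ℓ*`, and the double
series converges unconditionally in norm. -/
def HasRenormalizedAction (K : Matrix (Fin D) (Fin D) ℂ) (B : Fin N → Matrix (Fin D) (Fin D) ℂ)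
    (g : Fin N → Lp ℂ 2 μ) (ω : X → ℝ) (e : ι → Lp ℂ 2 μ)
    (he : ∀ l, e l ∈ (mulOp μ ω).domain) (Ψ Φ : Fock μ D) : Prop :=
  ∃ (u : ι → Fock μ D) (w : ι → ι → Fock μ D),
    (∀ l', (Ψ, u l') ∈ (displaced B g (e l')).graph) ∧
    (∀ l l', (u l', w l l') ∈ ((displaced B g (e l))†).graph) ∧
    ∃ S, HasSum (fun p : ι × ι => ⟪e p.1, mulOp μ ω ⟨e p.2, he p.2⟩⟫_ℂ • w p.1 p.2) S ∧
      Φ = S + spin μ K Ψ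

end Model

section Friedrichs

variable {E : Type*} [NormedAddCommGroup E] [InnerProductSpace ℂ E]

/-- `⟨ψ, A ψ⟩ ≥ c ‖ψ‖²` on the domain of `A`. -/
def IsBoundedBelowBy (A : E →ₗ.[ℂ] E) (c : ℝ) : Prop :=
  ∀ ψ : A.domain, c * ‖(ψ : E)‖ ^ 2 ≤ (⟪(ψ : E), A ψ⟫_ℂ).re

/-- The domain of the closure of the quadratic form `ψ ↦ ⟨ψ, A ψ⟩` of a symmetric operator `A`
that is bounded below: limits of sequences in the domain of `A` that are Cauchy with respect to
the form. -/
def formDomain (A : E →ₗ.[ℂ] E) : Set E :=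
  {ψ | ∃ u : ℕ → A.domain, Tendsto (fun n => (u n : E)) atTop (𝓝 ψ) ∧
    Tendsto (fun p : ℕ × ℕ => (⟪((u p.1 - u p.2 : A.domain) : E), A (u p.1 - u p.2)⟫_ℂ).re)
      atTop (𝓝 0)}

/-- `F` is the Friedrichs extension of `A`: the restriction of the adjoint of `A` to the vectors
of its domain that lie in the form domain of `A`. -/
def IsFriedrichsExtension [CompleteSpace E] (A F : E →ₗ.[ℂ] E) : Prop :=
  F ≤ A† ∧ ∀ ψ, ψ ∈ F.domain ↔ ψ ∈ A†.domain ∧ ψ ∈ formDomain A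

end Friedrichs

end GSB

end

/-! The dressed vacuum `T (v ⊗ Ω)` is a vacuum for the displaced operators. Indeed `[a(h), G] = -∑ⱼ
⟨h, gⱼ⟩ Bⱼ` with `gⱼ = fⱼ / ω`; this commutes with `G` because the `Bⱼ` commute, and `a(h)` kills `v
⊗ Ω`, so `â(h) T (v ⊗ Ω) = 0` for every `h` (`displacedFormal_dressedVacuum`). The matrix shift in
`â(h)` commutes with all `a*(f)`, so the canonical commutation relations persist, and `â_ℓ` kills a
dressed test vector unless `ℓ` is one of its indices (`displacedFormal_createList_eq_zero`). Hence
only finitely many `ℓ'` contribute to `H Ψ`. For each of them the sum over `ℓ` is the basis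
expansion of `ω e_ℓ'`, pushed through the bounded linear map `h ↦ â(h)* Φ` with `Φ = â_ℓ' Ψ`; no
bound on `ω` is needed.

The form of `H - K` is `∑ ⟨e_ℓ, ω e_ℓ'⟩ ⟨â_ℓ Ψ, â_ℓ' Φ⟩`. Its coefficients are the Gram matrix of
the vectors `√ω e_ℓ`, so the form is Hermitian, and it is nonnegative by the Schur product theorem.
Thus `c = -‖K ⊗ 1‖` is a lower bound.

For density, `T` is undone: the partial sums of `exp (-G) T (v ⊗ Ω)` are combinations of creation
operators applied to dressed vacua, since `Bⱼ T (v ⊗ Ω) = T (Bⱼ v ⊗ Ω)`, and they converge to `v ⊗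
Ω`. Arbitrary one-particle functions are approximated by combinations of the `e_ℓ`, and the vectors
`a*(h₁) ⋯ a*(hₙ) (v ⊗ Ω)` are total.

Domains are kept apart from algebra: identities are proved for arbitrary sequences of components,
and all vectors that occur in the constructions decay faster than geometrically in the boson number,
which puts them in every domain needed.

The Friedrichs extension comes from the Hilbert space completion `V` of the form domain. The adjoint
of `j : V → E` produces preimages under `F + (1 - c)`, and a symmetric operator with a surjective
real shift is self-adjoint. -/

noncomputable section

namespace GSB

/-! ### The Friedrichs extension of a semibounded symmetric operator -/

section FriedrichsExtension

variable {E : Type*} [NormedAddCommGroup E] [InnerProductSpace ℂ E]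

/-- A Hilbert space `V` with a bounded map `j : V → E` realises the completion of the domain of `A`
for the inner product `⟨u, A v⟩ + (1 - c) ⟨u, v⟩`. -/
structure IsFormCompletion (A : E →ₗ.[ℂ] E) (c : ℝ) {V : Type*} [NormedAddCommGroup V]
    [InnerProductSpace ℂ V] (i : A.domain →ₗ[ℂ] V) (j : V →L[ℂ] E) : Prop where
  denseRange : DenseRange i
  inner_eq : ∀ u v : A.domain,
    ⟪i u, i v⟫_ℂ = ⟪(u : E), A v⟫_ℂ + ((1 - c : ℝ) : ℂ) * ⟪(u : E), (v : E)⟫_ℂ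
  comp_eq : ∀ u : A.domain, j (i u) = u
  norm_le : ∀ x, ‖j x‖ ≤ ‖x‖

/-- The space `W` is abstract because `A.domain`, to which this is applied, already carries the norm
of `E`, which would clash with the norm of the core. -/
theorem exists_completion_of_core.{u} {E : Type*} [NormedAddCommGroup E] [InnerProductSpace ℂ E]
    [CompleteSpace E] {W : Type u} [AddCommGroup W] [Module ℂ W] (core : InnerProductSpace.Core ℂ W)
    (j₀ : W →ₗ[ℂ] E) (hj₀ : ∀ u, ‖j₀ u‖ ^ 2 ≤ (core.inner u u).re) :
    ∃ (V : Type u) (_ : NormedAddCommGroup V) (_ : InnerProductSpace ℂ V) (_ : CompleteSpace V)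
      (i : W →ₗ[ℂ] V) (j : V →L[ℂ] E), DenseRange i ∧ (∀ u v, ⟪i u, i v⟫_ℂ = core.inner u v) ∧
      (∀ u, j (i u) = j₀ u) ∧ ∀ x, ‖j x‖ ≤ ‖x‖ := by
  let _ : NormedAddCommGroup W := core.toNormedAddCommGroup
  let _ : InnerProductSpace ℂ W := InnerProductSpace.ofCore core.toCore
  have hj0 : ∀ u : W, ‖j₀ u‖ ≤ 1 * ‖u‖ := by
    intro u
    rw [one_mul]
    refine le_of_sq_le_sq ?_ (norm_nonneg _)
    rw [← inner_self_eq_norm_sq (𝕜 := ℂ) u]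
    exact hj₀ u
  let j1 : W →L[ℂ] E := j₀.mkContinuous 1 hj0
  let i0 : W →L[ℂ] UniformSpace.Completion W := UniformSpace.Completion.toComplL
  have hi0 : IsUniformInducing i0 := UniformSpace.Completion.isUniformInducing_coe W
  have hd0 : DenseRange i0 := UniformSpace.Completion.denseRange_coe
  have hcomp : ∀ u, j1.extend i0 (i0 u) = j1 u := fun u =>
    ContinuousLinearMap.extend_eq _ hd0 hi0 u
  refine ⟨UniformSpace.Completion W, inferInstance, inferInstance, inferInstance,
    i0.toLinearMap, j1.extend i0, hd0, fun u v => ?_, hcomp, fun x => ?_⟩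
  · exact UniformSpace.Completion.inner_coe (𝕜 := ℂ) (E := W) u v
  · refine hd0.induction_on (p := fun x => ‖j1.extend i0 x‖ ≤ ‖x‖) x
      (isClosed_le (by fun_prop) (by fun_prop)) fun u => ?_
    rw [hcomp]
    have := hj0 u
    rw [one_mul] at this
    exact this.trans (UniformSpace.Completion.norm_coe u).ge

/-- The shift `1 - c` makes the form dominate `‖u‖ ^ 2`. This gives definiteness and the bound `1`
for the inclusion into `E` at once. -/
theorem exists_isFormCompletion.{u} {E : Type u} [NormedAddCommGroup E] [InnerProductSpace ℂ E]
    [CompleteSpace E] {A : E →ₗ.[ℂ] E} (hA : A.IsFormalAdjoint A) {c : ℝ}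
    (hc : IsBoundedBelowBy A c) :
    ∃ (V : Type u) (_ : NormedAddCommGroup V) (_ : InnerProductSpace ℂ V) (_ : CompleteSpace V)
      (i : A.domain →ₗ[ℂ] V) (j : V →L[ℂ] E), IsFormCompletion A c i j := by
  have key : ∀ u : A.domain, ‖(u : E)‖ ^ 2 ≤
      (⟪(u : E), A u⟫_ℂ + ((1 - c : ℝ) : ℂ) * ⟪(u : E), (u : E)⟫_ℂ).re := by
    intro u
    have h1 := hc u
    rw [inner_self_eq_norm_sq_to_K]
    simp only [Complex.add_re, Complex.coe_algebraMap, ← Complex.ofReal_pow, ← Complex.ofReal_mul,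
      Complex.ofReal_re]
    linarith
  let core : InnerProductSpace.Core ℂ A.domain :=
    { inner := fun u v => ⟪(u : E), A v⟫_ℂ + ((1 - c : ℝ) : ℂ) * ⟪(u : E), (v : E)⟫_ℂ
      conj_inner_symm := fun u v => by
        simp only [map_add, map_mul, inner_conj_symm, Complex.conj_ofReal]
        rw [hA u v]
      re_inner_nonneg := fun u => (sq_nonneg _).trans (key u)
      add_left := fun u v w => by
        simp only [Submodule.coe_add, inner_add_left]
        ring
      smul_left := fun u v r => by
        simp only [Submodule.coe_smul, inner_smul_left]
        ring
      definite := fun u hu => by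
        have h := key u
        have hu' : ⟪(u : E), A u⟫_ℂ + ((1 - c : ℝ) : ℂ) * ⟪(u : E), (u : E)⟫_ℂ = 0 := hu
        rw [hu', Complex.zero_re] at h
        have : ‖(u : E)‖ = 0 := by nlinarith [norm_nonneg (u : E)]
        exact Subtype.ext (norm_eq_zero.1 this) }
  obtain ⟨V, _, _, _, i, j, h1, h2, h3, h4⟩ := exists_completion_of_core core A.domain.subtype key
  exact ⟨V, _, _, ‹_›, i, j, h1, h2, h3, h4⟩

variable {A : E →ₗ.[ℂ] E} {c : ℝ} {V : Type*} [NormedAddCommGroup V] [InnerProductSpace ℂ V]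
  {i : A.domain →ₗ[ℂ] V} {j : V →L[ℂ] E}

theorem IsFormCompletion.norm_sq (h : IsFormCompletion A c i j) (u : A.domain) :
    ‖i u‖ ^ 2 = (⟪(u : E), A u⟫_ℂ).re + (1 - c) * ‖(u : E)‖ ^ 2 := by
  rw [← inner_self_eq_norm_sq (𝕜 := ℂ), h.inner_eq, inner_self_eq_norm_sq_to_K]
  simp [← Complex.ofReal_pow]

/-- By `norm_sq`, a sequence that converges in `E` is Cauchy for the form exactly when it is Cauchy
in `V`, whatever the sign of `1 - c`. Completeness of `V` gives one inclusion and density of the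
range of `i` the other. -/
theorem IsFormCompletion.formDomain_eq [CompleteSpace V] (h : IsFormCompletion A c i j) :
    formDomain A = Set.range j := by
  ext ψ
  constructor
  · rintro ⟨u, hu, hform⟩
    have hcau : CauchySeq fun n => i (u n) := by
      rw [cauchySeq_iff_tendsto_dist_atTop_0]
      have h1 : Tendsto (fun p : ℕ × ℕ => ‖i (u p.1 - u p.2)‖ ^ 2) atTop (𝓝 0) := by
        have h2 : Tendsto (fun p : ℕ × ℕ => ‖((u p.1 - u p.2 : A.domain) : E)‖) atTop (𝓝 0) := by
          have := (cauchySeq_iff_tendsto_dist_atTop_0 (u := fun n => (u n : E))).1 hu.cauchySeq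
          simpa [dist_eq_norm] using this
        have h3 := hform.add ((h2.pow 2).const_mul (1 - c))
        simp only [ne_eq, OfNat.ofNat_ne_zero, not_false_eq_true, zero_pow, mul_zero,
          add_zero] at h3
        exact h3.congr fun p => (h.norm_sq _).symm
      have h4 := h1.sqrt
      rw [Real.sqrt_zero] at h4
      refine h4.congr fun p => ?_
      rw [Real.sqrt_sq (norm_nonneg _), map_sub, dist_eq_norm]
    obtain ⟨x, hx⟩ := cauchySeq_tendsto_of_complete hcau
    refine ⟨x, tendsto_nhds_unique ((j.continuous.tendsto x).comp hx) ?_⟩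
    exact hu.congr fun n => (h.comp_eq _).symm
  · rintro ⟨x, rfl⟩
    obtain ⟨y, hy, hyx⟩ := mem_closure_iff_seq_limit.1 (h.denseRange x)
    choose u hu using hy
    have hux : Tendsto (fun n => i (u n)) atTop (𝓝 x) := by simpa only [hu] using hyx
    have hjx : Tendsto (fun n => (u n : E)) atTop (𝓝 (j x)) := by
      simpa only [Function.comp_def, h.comp_eq] using (j.continuous.tendsto x).comp hux
    refine ⟨u, hjx, ?_⟩
    have h1 := (cauchySeq_iff_tendsto_dist_atTop_0 (u := fun n => i (u n))).1 hux.cauchySeq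
    have h2 := (cauchySeq_iff_tendsto_dist_atTop_0 (u := fun n => (u n : E))).1 hjx.cauchySeq
    have h3 := (h1.pow 2).sub ((h2.pow 2).const_mul (1 - c))
    simp only [ne_eq, OfNat.ofNat_ne_zero, not_false_eq_true, zero_pow, mul_zero, sub_zero] at h3
    refine h3.congr fun p => ?_
    have h4 := h.norm_sq (u p.1 - u p.2)
    rw [dist_eq_norm, dist_eq_norm, ← map_sub, h4, Submodule.coe_sub]
    ring

/-- With `A` on the fixed vector `u`, both sides are continuous in `x`, so the identity extends from
the dense range of `i`. It contains closability of the form: `j x = 0` makes `x` orthogonal to a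
dense set. -/
theorem IsFormCompletion.inner_coe (h : IsFormCompletion A c i j) (hA : A.IsFormalAdjoint A)
    (u : A.domain) (x : V) :
    ⟪i u, x⟫_ℂ = ⟪A u, j x⟫_ℂ + ((1 - c : ℝ) : ℂ) * ⟪(u : E), j x⟫_ℂ := by
  refine h.denseRange.induction_on (p := fun x => ⟪i u, x⟫_ℂ = ⟪A u, j x⟫_ℂ +
    ((1 - c : ℝ) : ℂ) * ⟪(u : E), j x⟫_ℂ) x
    (isClosed_eq (by fun_prop) (by fun_prop)) fun v => ?_
  rw [h.inner_eq, h.comp_eq, hA u v]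

variable [CompleteSpace E]

/-- On vectors of `V` whose image lies in the domain of `A†`, the operator `A† + (1 - c)` represents
the inner product of `V`. Symmetry and the lower bound of the extension are read off from this. -/
theorem IsFormCompletion.inner_adjoint (h : IsFormCompletion A c i j) (hA : A.IsFormalAdjoint A)
    (hd : Dense (A.domain : Set E)) (x y : V) (hy : j y ∈ A†.domain) :
    ⟪j x, A† ⟨j y, hy⟩⟫_ℂ + ((1 - c : ℝ) : ℂ) * ⟪j x, j y⟫_ℂ = ⟪x, y⟫_ℂ := by
  refine h.denseRange.induction_on (p := fun x => ⟪j x, A† ⟨j y, hy⟩⟫_ℂ +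
    ((1 - c : ℝ) : ℂ) * ⟪j x, j y⟫_ℂ = ⟪x, y⟫_ℂ) x
    (isClosed_eq (by fun_prop) (by fun_prop)) fun u => ?_
  rw [h.inner_coe hA, h.comp_eq, (LinearPMap.adjoint_isFormalAdjoint hd).symm u ⟨j y, hy⟩]

/-- Riesz representation in `V`: the solution is `x = j* η`, since `⟪i u, j* η⟫ = ⟪u, η⟫` for all
`u` in the domain. -/
theorem IsFormCompletion.exists_adjoint_eq [CompleteSpace V] (h : IsFormCompletion A c i j)
    (hA : A.IsFormalAdjoint A) (hd : Dense (A.domain : Set E)) (η : E) :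
    ∃ (x : V) (hx : j x ∈ A†.domain), A† ⟨j x, hx⟩ + ((1 - c : ℝ) : ℂ) • j x = η := by
  have key : ∀ u : A.domain, ⟪η - ((1 - c : ℝ) : ℂ) • j (j.adjoint η), (u : E)⟫_ℂ =
      ⟪j (j.adjoint η), A u⟫_ℂ := by
    intro u
    have h1 := h.inner_coe hA u (j.adjoint η)
    rw [ContinuousLinearMap.adjoint_inner_right, h.comp_eq] at h1
    have h2 := congrArg (starRingEnd ℂ) h1
    simp only [map_add, map_mul, inner_conj_symm, Complex.conj_ofReal] at h2
    rw [inner_sub_left, inner_smul_left, Complex.conj_ofReal, h2]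
    ring
  have hx : j (j.adjoint η) ∈ A†.domain := LinearPMap.mem_adjoint_domain_of_exists _ ⟨_, key⟩
  refine ⟨j.adjoint η, hx, ?_⟩
  rw [LinearPMap.adjoint_apply_eq hd ⟨_, hx⟩ key, sub_add_cancel]

/-- A densely defined symmetric operator `F` such that `F + a` is onto for some real `a` is
self-adjoint. -/
theorem isSelfAdjoint_of_surjective {F : E →ₗ.[ℂ] E} (hF : F.IsFormalAdjoint F)
    (hd : Dense (F.domain : Set E)) (a : ℝ)
    (hs : ∀ η : E, ∃ x : F.domain, F x + (a : ℂ) • (x : E) = η) : IsSelfAdjoint F := by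
  rw [LinearPMap.isSelfAdjoint_def]
  have hle : F ≤ F† := hF.le_adjoint hd
  refine (LinearPMap.eq_of_le_of_domain_eq hle (le_antisymm hle.1 fun φ hφ => ?_)).symm
  -- Solve `(F + a) ψ = (F† + a) φ` inside the domain of `F`. Then `φ - ψ` is orthogonal to the
  -- range of `F + a`, which is everything, so `φ = ψ`.
  obtain ⟨ψ, hψ⟩ := hs (F† ⟨φ, hφ⟩ + (a : ℂ) • φ)
  suffices φ = ψ from this ▸ ψ.2
  refine ext_inner_left ℂ fun η => ?_
  obtain ⟨χ, rfl⟩ := hs η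
  have h1 : ⟪(χ : E), F† ⟨φ, hφ⟩ + (a : ℂ) • φ⟫_ℂ = ⟪F χ + (a : ℂ) • (χ : E), φ⟫_ℂ := by
    rw [inner_add_right, inner_add_left, inner_smul_left, inner_smul_right, Complex.conj_ofReal,
      (LinearPMap.adjoint_isFormalAdjoint hd).symm χ ⟨φ, hφ⟩]
  have h2 : ⟪(χ : E), F ψ + (a : ℂ) • (ψ : E)⟫_ℂ = ⟪F χ + (a : ℂ) • (χ : E), (ψ : E)⟫_ℂ := by
    rw [inner_add_right, inner_add_left, inner_smul_left, inner_smul_right, Complex.conj_ofReal,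
      hF χ ψ]
  rw [← h1, ← h2, hψ]

/-- The Friedrichs extension of a densely defined symmetric operator that is bounded below. -/
theorem exists_isFriedrichsExtension (hA : A.IsFormalAdjoint A)
    (hd : Dense (A.domain : Set E)) (hc : IsBoundedBelowBy A c) :
    ∃ F : E →ₗ.[ℂ] E, IsFriedrichsExtension A F ∧ A ≤ F ∧ IsSelfAdjoint F ∧
      IsBoundedBelowBy F c := by
  obtain ⟨V, _, _, _, i, j, h⟩ := exists_isFormCompletion hA hc
  have hfd := h.formDomain_eq
  set F : E →ₗ.[ℂ] E := (A†).domRestrict (LinearMap.range j.toLinearMap) with hF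
  have hdom : ∀ ψ, ψ ∈ F.domain ↔ ψ ∈ A†.domain ∧ ψ ∈ formDomain A := by
    intro ψ
    rw [hfd, and_comm]
    rfl
  have hFA : F ≤ A† := LinearPMap.domRestrict_le
  have hval : ∀ ψ : F.domain, ∃ (x : V) (hx : j x ∈ A†.domain),
      (ψ : E) = j x ∧ F ψ = A† ⟨j x, hx⟩ := by
    rintro ⟨ψ, ⟨x, hx⟩, hψ⟩
    change j x = ψ at hx
    subst hx
    exact ⟨x, hψ, rfl, hFA.2 rfl⟩
  have hAF : A ≤ F := by
    have hle := hA.le_adjoint hd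
    refine ⟨fun ψ hψ => ⟨⟨i ⟨ψ, hψ⟩, h.comp_eq _⟩, hle.1 hψ⟩, fun u v huv => ?_⟩
    exact (hle.2 (y := ⟨u, hle.1 u.2⟩) rfl).trans (hFA.2 (y := ⟨u, hle.1 u.2⟩) huv.symm).symm
  have hsym : F.IsFormalAdjoint F := by
    intro φ ψ
    obtain ⟨x, hx, h1, h2⟩ := hval φ
    obtain ⟨y, hy, h3, h4⟩ := hval ψ
    have e1 := h.inner_adjoint hA hd x y hy
    have e2 := congrArg (starRingEnd ℂ) (h.inner_adjoint hA hd y x hx)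
    simp only [map_add, map_mul, inner_conj_symm, Complex.conj_ofReal] at e2
    rw [h1, h2, h3, h4]
    exact add_right_cancel (e2.trans e1.symm)
  refine ⟨F, ⟨hFA, hdom⟩, hAF,
    isSelfAdjoint_of_surjective hsym (hd.mono hAF.1) (1 - c) fun η => ?_, fun ψ => ?_⟩
  · obtain ⟨x, hx, hη⟩ := h.exists_adjoint_eq hA hd η
    refine ⟨⟨j x, ⟨x, rfl⟩, hx⟩, ?_⟩
    rw [← hη]
    congr 1
  -- Here `⟪ψ, F ψ⟫ + (1 - c) ‖ψ‖ ^ 2 = ‖x‖ ^ 2 ≥ ‖j x‖ ^ 2 = ‖ψ‖ ^ 2`, so the shift by `1` cancels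
  -- and the bound `c` survives unchanged.
  · obtain ⟨x, hx, h1, h2⟩ := hval ψ
    have e1 := congrArg Complex.re (h.inner_adjoint hA hd x x hx)
    have e2 := h.norm_le x
    have e3 : (⟪x, x⟫_ℂ).re = ‖x‖ ^ 2 := inner_self_eq_norm_sq (𝕜 := ℂ) x
    rw [inner_self_eq_norm_sq_to_K (j x), e3] at e1
    simp only [Complex.add_re, Complex.coe_algebraMap, ← Complex.ofReal_pow,
      ← Complex.ofReal_mul, Complex.ofReal_re] at e1
    rw [h1, h2]
    nlinarith [norm_nonneg (j x)]

end FriedrichsExtension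

/-! ### Functions determined by their integrals over rectangles -/

section Density

/-- A function on a product space whose integrals over all rectangles with sides of finite measure
vanish is zero almost everywhere. -/
theorem ae_eq_zero_of_setIntegral_rectangle_eq_zero {α β G : Type*} [MeasurableSpace α]
    [MeasurableSpace β] [NormedAddCommGroup G] [NormedSpace ℝ G] [CompleteSpace G]
    {μ : Measure α} {ν : Measure β} [SigmaFinite μ] [SigmaFinite ν] {Φ : α × β → G}
    (hΦ : MemLp Φ 2 (μ.prod ν))
    (h : ∀ s t, MeasurableSet s → MeasurableSet t → μ s ≠ ∞ → ν t ≠ ∞ →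
      ∫ p in s ×ˢ t, Φ p ∂(μ.prod ν) = 0) : Φ =ᵐ[μ.prod ν] 0 := by
  -- On a rectangle `R` of finite measure the function is integrable, so it can be tested against
  -- all measurable sets. Countably many such rectangles cover the product.
  have key : ∀ kl : ℕ × ℕ, ∀ᵐ p ∂((μ.prod ν).restrict
      (spanningSets μ kl.1 ×ˢ spanningSets ν kl.2)), Φ p = (0 : α × β → G) p := by
    intro kl
    set R := spanningSets μ kl.1 ×ˢ spanningSets ν kl.2 with hR
    have hRm : MeasurableSet R :=
      (measurableSet_spanningSets μ _).prod (measurableSet_spanningSets ν _)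
    have hRfin : (μ.prod ν) R < ∞ := by
      rw [hR, Measure.prod_prod]
      exact ENNReal.mul_lt_top (measure_spanningSets_lt_top μ _) (measure_spanningSets_lt_top ν _)
    have : IsFiniteMeasure ((μ.prod ν).restrict R) := isFiniteMeasure_restrict.2 hRfin.ne
    have hint : Integrable Φ ((μ.prod ν).restrict R) :=
      (hΦ.restrict R).integrable (by norm_num)
    have hall : ∀ C, MeasurableSet C → ∫ p in C, Φ p ∂((μ.prod ν).restrict R) = 0 := by
      intro C hC
      have hrect : ∀ s t, MeasurableSet s → MeasurableSet t →
          ∫ p in s ×ˢ t, Φ p ∂((μ.prod ν).restrict R) = 0 := by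
        intro s t hs ht
        rw [Measure.restrict_restrict (hs.prod ht), hR, Set.prod_inter_prod]
        refine h _ _ (hs.inter (measurableSet_spanningSets μ _))
          (ht.inter (measurableSet_spanningSets ν _)) ?_ ?_
        · exact ((measure_mono Set.inter_subset_right).trans_lt
            (measure_spanningSets_lt_top μ _)).ne
        · exact ((measure_mono Set.inter_subset_right).trans_lt
            (measure_spanningSets_lt_top ν _)).ne
      -- Dynkin's π-λ argument. The complement case needs the integral over all of `R` to vanish,
      -- and `R` is itself a rectangle.
      induction C, hC using MeasurableSpace.induction_on_inter generateFrom_prod.symm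
        isPiSystem_prod with
      | empty => simp
      | basic C hC =>
        obtain ⟨s, hs, t, ht, rfl⟩ := hC
        exact hrect s t hs ht
      | compl C hC ih =>
        have h1 := integral_add_compl hC hint
        have h2 := hrect Set.univ Set.univ MeasurableSet.univ MeasurableSet.univ
        rw [Set.univ_prod_univ, Measure.restrict_univ] at h2
        rw [ih, zero_add, h2] at h1
        exact h1
      | iUnion C hd hm ih =>
        rw [integral_iUnion hm hd hint.integrableOn]
        simp [ih]
    exact hint.ae_eq_zero_of_forall_setIntegral_eq_zero fun C hC _ => hall C hC
  have hU : ⋃ kl : ℕ × ℕ, spanningSets μ kl.1 ×ˢ spanningSets ν kl.2 = Set.univ := by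
    ext ⟨x, y⟩
    have hx : x ∈ ⋃ k, spanningSets μ k := by rw [iUnion_spanningSets]; trivial
    have hy : y ∈ ⋃ k, spanningSets ν k := by rw [iUnion_spanningSets]; trivial
    obtain ⟨k, hk⟩ := Set.mem_iUnion.1 hx
    obtain ⟨l, hl⟩ := Set.mem_iUnion.1 hy
    simp only [Set.mem_iUnion, Set.mem_univ, iff_true]
    exact ⟨(k, l), hk, hl⟩
  have := (ae_restrict_iUnion_iff (μ := μ.prod ν)
    (fun kl : ℕ × ℕ => spanningSets μ kl.1 ×ˢ spanningSets ν kl.2)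
    (fun p => Φ p = (0 : α × β → G) p)).2 key
  rwa [hU, Measure.restrict_univ] at this

end Density

/-! ### Tensor products and permutations of particles -/

section Tensor

variable {X : Type*} [MeasurableSpace X] {μ : Measure X} [SigmaFinite μ] {D : ℕ}

theorem coeFn_tensor (f : Lp ℂ 2 μ) {n : ℕ} (ψ : NBody μ D n) :
    tensor f ψ =ᵐ[Measure.pi (fun _ : Fin (n + 1) => μ)] fun k => f (k 0) • ψ (Fin.tail k) :=
  (memLp_tensor f ψ).coeFn_toLp

theorem ae_head {n : ℕ} {p : X → Prop} (h : ∀ᵐ x ∂μ, p x) :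
    ∀ᵐ k ∂(Measure.pi (fun _ : Fin (n + 1) => μ)), p (k 0) :=
  (Measure.quasiMeasurePreserving_fst.comp (measurePreserving_piFinSuccAbove
    (fun _ : Fin (n + 1) => μ) 0).quasiMeasurePreserving).ae h

theorem inner_tensor (f g : Lp ℂ 2 μ) {n : ℕ} (ψ φ : NBody μ D n) :
    ⟪tensor f ψ, tensor g φ⟫_ℂ = ⟪f, g⟫_ℂ * ⟪ψ, φ⟫_ℂ := by
  rw [L2.inner_def, L2.inner_def, L2.inner_def, ← integral_prod_mul,
    ← (measurePreserving_piFinSuccAbove (fun _ : Fin (n + 1) => μ) 0).integral_comp']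
  refine integral_congr_ae ?_
  filter_upwards [coeFn_tensor f ψ, coeFn_tensor g φ] with k h1 h2
  rw [h1, h2, inner_smul_left, inner_smul_right, ← mul_assoc]
  congr 1
  rw [RCLike.inner_apply', mul_comm]
  exact mul_comm _ _

theorem tensor_smul (f : Lp ℂ 2 μ) {n : ℕ} (c : ℂ) (ψ : NBody μ D n) :
    tensor f (c • ψ) = c • tensor f ψ := map_smul (tensorL D f n) c ψ

theorem tensor_sum (f : Lp ℂ 2 μ) {n : ℕ} {κ : Type*} (s : Finset κ) (ψ : κ → NBody μ D n) :
    tensor f (∑ i ∈ s, ψ i) = ∑ i ∈ s, tensor f (ψ i) := map_sum (tensorL D f n) ψ s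

theorem add_tensor (f g : Lp ℂ 2 μ) {n : ℕ} (ψ : NBody μ D n) :
    tensor (f + g) ψ = tensor f ψ + tensor g ψ := by
  refine Lp.ext ?_
  filter_upwards [coeFn_tensor (f + g) ψ, coeFn_tensor f ψ, coeFn_tensor g ψ,
    Lp.coeFn_add (tensor f ψ) (tensor g ψ), ae_head (Lp.coeFn_add f g)] with k h1 h2 h3 h4 h5
  rw [h1, h4, Pi.add_apply, h2, h3, h5, Pi.add_apply, add_smul]

theorem smul_tensor (c : ℂ) (f : Lp ℂ 2 μ) {n : ℕ} (ψ : NBody μ D n) :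
    tensor (c • f) ψ = c • tensor f ψ := by
  refine Lp.ext ?_
  filter_upwards [coeFn_tensor (c • f) ψ, coeFn_tensor f ψ,
    Lp.coeFn_smul c (tensor f ψ), ae_head (Lp.coeFn_smul c f)] with k h1 h2 h3 h4
  rw [h1, h3, Pi.smul_apply, h2, h4, Pi.smul_apply, smul_assoc]

theorem coeFn_permute {n : ℕ} (σ : Equiv.Perm (Fin n)) (ψ : NBody μ D n) :
    permute μ D σ ψ =ᵐ[Measure.pi (fun _ : Fin n => μ)] fun k => ψ (k ∘ σ) :=
  Lp.coeFn_compMeasurePreserving ψ (measurePreserving_perm μ σ)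

theorem permute_one {n : ℕ} (ψ : NBody μ D n) : permute μ D 1 ψ = ψ :=
  Lp.compMeasurePreserving_id_apply _

theorem inner_permute_left {n : ℕ} (σ : Equiv.Perm (Fin n)) (ψ φ : NBody μ D n) :
    ⟪permute μ D σ ψ, φ⟫_ℂ = ⟪ψ, permute μ D σ⁻¹ φ⟫_ℂ := by
  rw [← LinearIsometry.inner_map_map (permute μ D σ) ψ, permute_permute, mul_inv_cancel,
    permute_one]

/-- Permutations that fix the first particle. -/
theorem permute_tensor {n : ℕ} (σ : Equiv.Perm (Fin n)) (f : Lp ℂ 2 μ) (ψ : NBody μ D n) :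
    permute μ D (Equiv.Perm.decomposeFin.symm (0, σ)) (tensor f ψ) =
      tensor f (permute μ D σ ψ) := by
  refine Lp.ext ?_
  filter_upwards [coeFn_permute (Equiv.Perm.decomposeFin.symm (0, σ)) (tensor f ψ),
    (measurePreserving_perm μ (Equiv.Perm.decomposeFin.symm (0, σ))).quasiMeasurePreserving.ae
      (coeFn_tensor f ψ), coeFn_tensor f (permute μ D σ ψ), ae_tail (coeFn_permute σ ψ)]
    with k h1 h2 h3 h4
  rw [h1, h2, h3, h4]
  have e1 : (k ∘ (Equiv.Perm.decomposeFin.symm ((0 : Fin (n + 1)), σ))) 0 = k 0 := by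
    simp
  have e2 : Fin.tail (k ∘ (Equiv.Perm.decomposeFin.symm ((0 : Fin (n + 1)), σ))) =
      Fin.tail k ∘ σ := by
    funext i
    simp [Fin.tail]
  rw [e1, e2]

theorem permute_swap_tensor_tensor {n : ℕ} (f g : Lp ℂ 2 μ) (ψ : NBody μ D n) :
    permute μ D (Equiv.swap 0 1) (tensor f (tensor g ψ)) = tensor g (tensor f ψ) := by
  have e : ∀ f g : Lp ℂ 2 μ, ∀ᵐ k ∂(Measure.pi (fun _ : Fin (n + 2) => μ)),
      tensor f (tensor g ψ) k = f (k 0) • g (k 1) • ψ (Fin.tail (Fin.tail k)) := by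
    intro f g
    filter_upwards [coeFn_tensor f (tensor g ψ), ae_tail (coeFn_tensor g ψ)] with k h1 h2
    rw [h1, h2]
    rfl
  refine Lp.ext ?_
  filter_upwards [coeFn_permute (Equiv.swap 0 1) (tensor f (tensor g ψ)),
    (measurePreserving_perm μ (Equiv.swap (0 : Fin (n + 2)) 1)).quasiMeasurePreserving.ae (e f g),
    e g f] with k h1 h2 h3
  rw [h1, h2, h3, smul_comm]
  have e1 : Fin.tail (Fin.tail (k ∘ Equiv.swap (0 : Fin (n + 2)) 1)) =
      Fin.tail (Fin.tail k) := by
    funext i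
    simp only [Fin.tail, Function.comp_apply]
    rw [Equiv.swap_apply_of_ne_of_ne (Fin.succ_ne_zero _)]
    rw [← Fin.succ_zero_eq_one, Ne, Fin.succ_inj]
    exact Fin.succ_ne_zero _
  simp [e1]

/-- The tensors `f ⊗ ψ` are total. -/
theorem eq_zero_of_inner_tensor_eq_zero {n : ℕ} (φ : NBody μ D (n + 1))
    (h : ∀ (f : Lp ℂ 2 μ) (ψ : NBody μ D n), ⟪tensor f ψ, φ⟫_ℂ = 0) : φ = 0 := by
  set e := MeasurableEquiv.piFinSuccAbove (fun _ : Fin (n + 1) => X) 0 with he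
  have hmp := measurePreserving_piFinSuccAbove (fun _ : Fin (n + 1) => μ) 0
  have hmem : MemLp (fun p => φ (e.symm p)) 2 (μ.prod (Measure.pi (fun _ : Fin n => μ))) :=
    (Lp.memLp φ).comp_measurePreserving (hmp.symm e)
  have hzero : (fun p => φ (e.symm p)) =ᵐ[μ.prod (Measure.pi (fun _ : Fin n => μ))] 0 := by
    refine ae_eq_zero_of_setIntegral_rectangle_eq_zero hmem fun s t hs ht hμs hμt => ?_
    have hms : MeasurableSet (e ⁻¹' (s ×ˢ t)) := e.measurable (hs.prod ht)
    have hfin : Measure.pi (fun _ : Fin (n + 1) => μ) (e ⁻¹' (s ×ˢ t)) ≠ ∞ := by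
      rw [hmp.measure_preimage (hs.prod ht).nullMeasurableSet, Measure.prod_prod]
      exact ENNReal.mul_ne_top hμs hμt
    have hpre : ∫ k in e ⁻¹' (s ×ˢ t), φ k ∂(Measure.pi (fun _ : Fin (n + 1) => μ)) = 0 := by
      refine ext_inner_left ℂ fun v => ?_
      rw [← L2.inner_indicatorConstLp_eq_inner_setIntegral ℂ hms hfin v, inner_zero_right]
      -- `1_s ⊗ (1_t v)` is the indicator of the rectangle with value `v`, and its inner product
      -- with `φ` is `⟪v, ∫ φ⟫` over that rectangle.
      convert h (indicatorConstLp 2 hs hμs 1) (indicatorConstLp 2 ht hμt v) using 2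
      refine Lp.ext ?_
      filter_upwards [coeFn_tensor (indicatorConstLp 2 hs hμs (1 : ℂ))
        (indicatorConstLp 2 ht hμt v : NBody μ D n),
        indicatorConstLp_coeFn (p := 2) (hs := hms) (hμs := hfin) (c := v),
        ae_head (n := n) (indicatorConstLp_coeFn (p := 2) (hs := hs) (hμs := hμs) (c := (1 : ℂ))),
        ae_tail (indicatorConstLp_coeFn (p := 2) (hs := ht) (hμs := hμt) (c := v))]
        with k h1 h2 h3 h4
      rw [h1, h2, h3, h4]
      have hk : k ∈ e ⁻¹' (s ×ˢ t) ↔ k 0 ∈ s ∧ Fin.tail k ∈ t := Iff.rfl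
      by_cases hks : k 0 ∈ s <;> by_cases hkt : Fin.tail k ∈ t <;>
        simp [Set.indicator, hk, hks, hkt]
    rw [← hpre, ← hmp.setIntegral_preimage_emb e.measurableEmbedding, he]
    simp only [MeasurableEquiv.symm_apply_apply]
  refine Lp.ext ?_
  have h1 := hmp.quasiMeasurePreserving.ae hzero
  filter_upwards [h1, Lp.coeFn_zero (EuclideanSpace ℂ (Fin D)) 2
    (Measure.pi (fun _ : Fin (n + 1) => μ))] with k hk h0
  have hk' : φ (e.symm (e k)) = 0 := hk
  rw [h0, ← e.symm_apply_apply k, hk']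
  rfl

theorem eq_of_inner_tensor_eq {n : ℕ} {φ χ : NBody μ D (n + 1)}
    (h : ∀ (f : Lp ℂ 2 μ) (ψ : NBody μ D n), ⟪tensor f ψ, φ⟫_ℂ = ⟪tensor f ψ, χ⟫_ℂ) : φ = χ :=
  sub_eq_zero.1 (eq_zero_of_inner_tensor_eq_zero _ fun f ψ => by
    rw [inner_sub_right, h, sub_self])

end Tensor

/-! ### Symmetrization and the canonical commutation relations between sectors -/

section SectorOperators

variable {X : Type*} [MeasurableSpace X] {μ : Measure X} [SigmaFinite μ] {D : ℕ}

theorem average_apply {n : ℕ} (ψ : NBody μ D n) :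
    average μ D n ψ = ((n.factorial : ℂ)⁻¹) • ∑ σ : Equiv.Perm (Fin n), permute μ D σ ψ := by
  simp [average]

theorem average_of_mem {n : ℕ} {ψ : NBody μ D n} (hψ : ψ ∈ symSubmodule μ D n) :
    average μ D n ψ = ψ := by
  have hn : (n.factorial : ℂ) ≠ 0 := by exact_mod_cast n.factorial_ne_zero
  rw [average_apply, Finset.sum_congr rfl fun σ _ => hψ σ]
  simp [Fintype.card_perm, ← Nat.cast_smul_eq_nsmul ℂ, smul_smul, hn]

theorem average_average {n : ℕ} (ψ : NBody μ D n) :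
    average μ D n (average μ D n ψ) = average μ D n ψ :=
  average_of_mem (average_mem μ D n ψ)

theorem average_permute {n : ℕ} (τ : Equiv.Perm (Fin n)) (ψ : NBody μ D n) :
    average μ D n (permute μ D τ ψ) = average μ D n ψ := by
  simp only [average_apply, permute_permute]
  congr 1
  exact Fintype.sum_equiv (Equiv.mulRight τ) _ _ fun σ => rfl

theorem inner_average_left {n : ℕ} (ψ : NBody μ D n) {φ : NBody μ D n}
    (hφ : φ ∈ symSubmodule μ D n) : ⟪average μ D n ψ, φ⟫_ℂ = ⟪ψ, φ⟫_ℂ := by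
  have hn : (n.factorial : ℂ) ≠ 0 := by exact_mod_cast n.factorial_ne_zero
  rw [average_apply, inner_smul_left, sum_inner,
    Finset.sum_congr rfl fun σ _ => (inner_permute_left σ ψ φ).trans (by rw [hφ])]
  simp [Fintype.card_perm, hn]

/-- Coset decomposition: each permutation is a transposition `(0 p)` times a permutation fixing the
particle `0`. -/
theorem decomposeFin_symm_eq_swap_mul {n : ℕ} (p : Fin (n + 1)) (σ : Equiv.Perm (Fin n)) :
    Equiv.Perm.decomposeFin.symm (p, σ) =
      Equiv.swap 0 p * Equiv.Perm.decomposeFin.symm (0, σ) := by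
  ext i
  refine Fin.cases ?_ (fun i => ?_) i <;> simp

/-- Averaging first over the stabilizer of the particle `0` symmetrizes `ψ` alone; the `n + 1` coset
representatives remain. -/
theorem average_tensor {n : ℕ} (f : Lp ℂ 2 μ) (ψ : NBody μ D n) :
    average μ D (n + 1) (tensor f ψ) = ((n + 1 : ℂ)⁻¹) •
      ∑ p : Fin (n + 1), permute μ D (Equiv.swap 0 p) (tensor f (average μ D n ψ)) := by
  have h1 : ∀ p : Fin (n + 1), permute μ D (Equiv.swap 0 p) (tensor f (average μ D n ψ)) =
      ((n.factorial : ℂ)⁻¹) • ∑ σ : Equiv.Perm (Fin n),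
        permute μ D (Equiv.Perm.decomposeFin.symm (p, σ)) (tensor f ψ) := by
    intro p
    rw [average_apply, tensor_smul, map_smul, tensor_sum, map_sum]
    congr 1
    refine Finset.sum_congr rfl fun σ _ => ?_
    rw [decomposeFin_symm_eq_swap_mul, ← permute_permute, permute_tensor]
  rw [Finset.sum_congr rfl fun p _ => h1 p, ← Finset.smul_sum, smul_smul, average_apply,
    ← Fintype.sum_prod_type' (f := fun p σ =>
      permute μ D (Equiv.Perm.decomposeFin.symm (p, σ)) (tensor f ψ)),
    Nat.factorial_succ, Nat.cast_mul, mul_inv]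
  push_cast
  congr 1
  exact Fintype.sum_equiv Equiv.Perm.decomposeFin _ _ fun σ => by simp

theorem average_tensor_average {n : ℕ} (f : Lp ℂ 2 μ) (ψ : NBody μ D n) :
    average μ D (n + 1) (tensor f (average μ D n ψ)) = average μ D (n + 1) (tensor f ψ) := by
  rw [average_tensor, average_average, average_tensor]

theorem coe_createSector (f : Lp ℂ 2 μ) {n : ℕ} (ψ : Sector μ D n) :
    (createSector D f n ψ : NBody μ D (n + 1)) =
      ((Real.sqrt (n + 1) : ℝ) : ℂ) • average μ D (n + 1) (tensor f (ψ : NBody μ D n)) := rfl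

/-- The inner symmetrization is absorbed by the outer one, so both sides are the same multiple of
the symmetrization of `f ⊗ g ⊗ ψ`, where the order of `f` and `g` is immaterial. -/
theorem createSector_comm (f g : Lp ℂ 2 μ) {n : ℕ} (ψ : Sector μ D n) :
    createSector D f (n + 1) (createSector D g n ψ) =
      createSector D g (n + 1) (createSector D f n ψ) := by
  refine Subtype.ext ?_
  simp only [coe_createSector, tensor_smul, map_smul, average_tensor_average]
  rw [← average_permute (Equiv.swap 0 1) (tensor f (tensor g _)), permute_swap_tensor_tensor]

theorem createSector_add (f g : Lp ℂ 2 μ) (n : ℕ) :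
    createSector D (f + g) n = createSector D f n + createSector D g n := by
  ext1 ψ
  refine Subtype.ext ?_
  simp only [coe_createSector, add_tensor, map_add, smul_add, add_apply,
    Submodule.coe_add]

theorem createSector_smul (c : ℂ) (f : Lp ℂ 2 μ) (n : ℕ) :
    createSector D (c • f) n = c • createSector D f n := by
  ext1 ψ
  refine Subtype.ext ?_
  simp only [coe_createSector, smul_tensor, map_smul, smul_apply,
    Submodule.coe_smul, smul_comm c]

variable (D) in
/-- Contraction of the first particle with `f`. -/
def contract (f : Lp ℂ 2 μ) (n : ℕ) : NBody μ D (n + 1) →L[ℂ] NBody μ D n :=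
  ContinuousLinearMap.adjoint (tensorL D f n)

theorem inner_contract (f : Lp ℂ 2 μ) {n : ℕ} (ψ : NBody μ D n) (φ : NBody μ D (n + 1)) :
    ⟪ψ, contract D f n φ⟫_ℂ = ⟪tensor f ψ, φ⟫_ℂ :=
  ContinuousLinearMap.adjoint_inner_right _ _ _

theorem contract_mem (f : Lp ℂ 2 μ) {n : ℕ} {φ : NBody μ D (n + 1)}
    (hφ : φ ∈ symSubmodule μ D (n + 1)) : contract D f n φ ∈ symSubmodule μ D n := by
  intro σ
  refine ext_inner_left ℂ fun χ => ?_
  have h := inner_permute_left σ⁻¹ χ (contract D f n φ)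
  rw [inv_inv] at h
  rw [← h, inner_contract, inner_contract, ← permute_tensor, inner_permute_left, hφ]

/-- Against a symmetric function the symmetrization in `a*(f)` drops out, so the adjoint merely
contracts one variable. -/
theorem coe_annihilateSector (f : Lp ℂ 2 μ) {n : ℕ} (φ : Sector μ D (n + 1)) :
    (annihilateSector D f n φ : NBody μ D n) =
      ((Real.sqrt (n + 1) : ℝ) : ℂ) • contract D f n (φ : NBody μ D (n + 1)) := by
  have hmem : ((Real.sqrt (n + 1) : ℝ) : ℂ) • contract D f n (φ : NBody μ D (n + 1)) ∈
      symSubmodule μ D n := Submodule.smul_mem _ _ (contract_mem f φ.2)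
  suffices annihilateSector D f n φ = ⟨_, hmem⟩ from congrArg Subtype.val this
  refine ext_inner_left ℂ fun ψ => ?_
  rw [annihilateSector, ContinuousLinearMap.adjoint_inner_right, Submodule.coe_inner,
    Submodule.coe_inner, coe_createSector, inner_smul_left, inner_smul_right,
    inner_average_left _ φ.2, inner_contract, Complex.conj_ofReal]

theorem contract_tensor (h f : Lp ℂ 2 μ) {n : ℕ} (ψ : NBody μ D n) :
    contract D h n (tensor f ψ) = ⟪h, f⟫_ℂ • ψ := by
  refine ext_inner_left ℂ fun χ => ?_
  rw [inner_contract, inner_tensor, inner_smul_right]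

/-- Conjugation by `(1 q+1)`, which is the extension of `(0 q)` fixing `0`, carries `(0 1)` to `(0
q+1)`. -/
theorem swap_zero_succ_mul {n : ℕ} (q : Fin (n + 1)) :
    Equiv.swap 0 q.succ * Equiv.Perm.decomposeFin.symm (0, Equiv.swap 0 q) =
      Equiv.Perm.decomposeFin.symm (0, Equiv.swap 0 q) * Equiv.swap (0 : Fin (n + 2)) 1 := by
  have h : Equiv.Perm.decomposeFin.symm ((0 : Fin (n + 2)), Equiv.swap 0 q) =
      Equiv.swap 1 q.succ := by
    ext i
    refine Fin.cases ?_ (fun i => ?_) i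
    · rw [Equiv.swap_apply_of_ne_of_ne (by simp) (Fin.succ_ne_zero q).symm]
      simp
    · rw [Equiv.Perm.decomposeFin_symm_apply_succ, Equiv.swap_self, Equiv.refl_apply,
        ← Fin.succ_zero_eq_one, (Fin.succ_injective _).swap_apply]
  rw [h, Equiv.mul_swap_eq_swap_mul (Equiv.swap 1 q.succ) 0 1, Equiv.swap_apply_left,
    Equiv.swap_apply_of_ne_of_ne (by simp) (Fin.succ_ne_zero q).symm]

/-- The transposition moves `f` out of the contracted slot, so `h` meets a variable of `ψ`. Symmetry
of `ψ` reduces `(0 q+1)` to `(0 1)`, where the claim is checked against the total set of tensors `f'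
⊗ χ`. -/
theorem contract_permute_tensor (h f : Lp ℂ 2 μ) {n : ℕ} {ψ : NBody μ D (n + 1)}
    (hψ : ψ ∈ symSubmodule μ D (n + 1)) (q : Fin (n + 1)) :
    contract D h (n + 1) (permute μ D (Equiv.swap 0 q.succ) (tensor f ψ)) =
      permute μ D (Equiv.swap 0 q) (tensor f (contract D h n ψ)) := by
  refine (LinearIsometry.injective (permute μ D (Equiv.swap 0 q))) ?_
  rw [permute_permute, Equiv.swap_mul_self, permute_one]
  refine eq_of_inner_tensor_eq fun f' χ => ?_
  have h1 := inner_permute_left (Equiv.swap 0 q) (tensor f' χ)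
    (contract D h (n + 1) (permute μ D (Equiv.swap 0 q.succ) (tensor f ψ)))
  rw [Equiv.swap_inv] at h1
  have h2 : tensor f ψ =
      permute μ D (Equiv.Perm.decomposeFin.symm (0, Equiv.swap 0 q)) (tensor f ψ) := by
    rw [permute_tensor, hψ]
  rw [← h1, inner_contract, h2, permute_permute, swap_zero_succ_mul, ← permute_permute,
    ← permute_tensor, LinearIsometry.inner_map_map]
  have h3 := inner_permute_left (Equiv.swap 0 1) (tensor h (tensor f' χ)) (tensor f ψ)
  rw [Equiv.swap_inv] at h3
  rw [← h3, permute_swap_tensor_tensor, inner_tensor, inner_tensor, inner_contract]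

theorem sqrt_mul_sqrt_natCast_add_one (n : ℕ) :
    ((Real.sqrt (n + 1) : ℝ) : ℂ) * ((Real.sqrt (n + 1) : ℝ) : ℂ) = n + 1 := by
  rw [← Complex.ofReal_mul, Real.mul_self_sqrt (by positivity)]
  push_cast
  rfl

/-- The factor `√(n+1) ^ 2` cancels the weight `1 / (n+1)` of the cosets. The coset `p = 0`
contracts `h` with `f` and yields the scalar of the commutation relation; the others are the
exchange terms, which form `a*(f) a(h)`. -/
theorem coe_annihilateSector_createSector (h f : Lp ℂ 2 μ) {n : ℕ} (ψ : Sector μ D n) :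
    (annihilateSector D h n (createSector D f n ψ) : NBody μ D n) = ⟪h, f⟫_ℂ • (ψ : NBody μ D n) +
      ∑ q : Fin n, contract D h n
        (permute μ D (Equiv.swap 0 q.succ) (tensor f (ψ : NBody μ D n))) := by
  have hne : (n + 1 : ℂ) ≠ 0 := by exact_mod_cast n.succ_ne_zero
  have h0 : contract D h n (permute μ D (Equiv.swap 0 0) (tensor f (ψ : NBody μ D n))) =
      ⟪h, f⟫_ℂ • (ψ : NBody μ D n) := by
    rw [Equiv.swap_self]
    exact (congrArg _ (permute_one _)).trans (contract_tensor _ _ _)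
  rw [coe_annihilateSector, coe_createSector, map_smul, smul_smul, sqrt_mul_sqrt_natCast_add_one,
    average_tensor, average_of_mem ψ.2, map_smul, smul_smul, mul_inv_cancel₀ hne, one_smul,
    map_sum, Fin.sum_univ_succ, h0]

theorem annihilateSector_createSector_zero (h f : Lp ℂ 2 μ) (ψ : Sector μ D 0) :
    annihilateSector D h 0 (createSector D f 0 ψ) = ⟪h, f⟫_ℂ • ψ := by
  refine Subtype.ext ?_
  rw [coe_annihilateSector_createSector, Fin.sum_univ_zero, add_zero]
  rfl

/-- The canonical commutation relation between sectors. -/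
theorem annihilateSector_createSector_succ (h f : Lp ℂ 2 μ) {n : ℕ} (ψ : Sector μ D (n + 1)) :
    annihilateSector D h (n + 1) (createSector D f (n + 1) ψ) =
      createSector D f n (annihilateSector D h n ψ) + ⟪h, f⟫_ℂ • ψ := by
  have hne : (n + 1 : ℂ) ≠ 0 := by exact_mod_cast n.succ_ne_zero
  refine Subtype.ext ?_
  rw [Submodule.coe_add, coe_annihilateSector_createSector, coe_createSector,
    coe_annihilateSector, tensor_smul, map_smul, smul_smul, sqrt_mul_sqrt_natCast_add_one,
    average_tensor, average_of_mem (contract_mem h ψ.2), smul_smul, mul_inv_cancel₀ hne, one_smul,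
    Finset.sum_congr rfl fun q _ => contract_permute_tensor h f ψ.2 q]
  exact add_comm _ _

/-- The vector `v ⊗ Ω` of the sector without bosons. -/
def vacuumSector (μ : Measure X) [SigmaFinite μ] (v : EuclideanSpace ℂ (Fin D)) : Sector μ D 0 :=
  vacuum μ v 0

theorem coeFn_vacuumSector (v : EuclideanSpace ℂ (Fin D)) :
    (vacuumSector μ v : NBody μ D 0) =ᵐ[Measure.pi (fun _ : Fin 0 => μ)] fun _ => v := by
  have h : (vacuumSector μ v : NBody μ D 0) =
      indicatorConstLp 2 MeasurableSet.univ (by simp) v := by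
    rw [vacuumSector, vacuum, lp.single_apply_self]
  rw [h]
  exact indicatorConstLp_coeFn.trans (by simp)

/-- The space `Fin 0 → X` is a single point, so the value there determines the vector. -/
theorem exists_vacuumSector_eq (ψ : Sector μ D 0) : ∃ v, vacuumSector μ v = ψ := by
  refine ⟨(ψ : NBody μ D 0) default, Subtype.ext (Lp.ext ?_)⟩
  filter_upwards [coeFn_vacuumSector (μ := μ) ((ψ : NBody μ D 0) default)] with k hk
  rw [hk, Subsingleton.elim k default]

/-- `a*(f₁) ⋯ a*(fₙ) (v ⊗ Ω)` -/
def productVector (μ : Measure X) [SigmaFinite μ] (v : EuclideanSpace ℂ (Fin D)) :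
    ∀ {n : ℕ}, (Fin n → Lp ℂ 2 μ) → Sector μ D n
  | 0, _ => vacuumSector μ v
  | n + 1, f => createSector D (f 0) n (productVector μ v (Fin.tail f))

/-- A vector of the `n`-boson sector that is orthogonal to all product vectors is zero. -/
theorem eq_zero_of_inner_productVector_eq_zero :
    ∀ {n : ℕ} (φ : Sector μ D n),
      (∀ v (f : Fin n → Lp ℂ 2 μ), ⟪productVector μ v f, φ⟫_ℂ = 0) → φ = 0
  | 0, φ, h => by
    obtain ⟨v, rfl⟩ := exists_vacuumSector_eq φ
    exact inner_self_eq_zero.1 (h v Fin.elim0)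
  | n + 1, φ, h => by
    -- Moving one creation operator across the inner product shows that `a(f) φ` is orthogonal to
    -- all shorter product vectors. Hence it vanishes by induction, and `φ` is orthogonal to every
    -- `f ⊗ ψ`.
    have h1 : ∀ f : Lp ℂ 2 μ, annihilateSector D f n φ = 0 := fun f =>
      eq_zero_of_inner_productVector_eq_zero _ fun v g => by
        have := h v (Fin.cons f g)
        rwa [productVector, Fin.cons_zero, Fin.tail_cons,
          ← ContinuousLinearMap.adjoint_inner_right] at this
    refine Subtype.ext (eq_zero_of_inner_tensor_eq_zero _ fun f ψ => ?_)
    have h2 := coe_annihilateSector f φ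
    rw [h1, Submodule.coe_zero] at h2
    have h3 : ((Real.sqrt (n + 1) : ℝ) : ℂ) ≠ 0 := by
      exact_mod_cast (Real.sqrt_pos.2 (by positivity)).ne'
    rw [← inner_contract, (smul_eq_zero.1 h2.symm).resolve_left h3, inner_zero_right]

end SectorOperators

/-! ### Matrices acting on the values, commuting with operations on the particles -/

section SpinSector

variable {X : Type*} [MeasurableSpace X] {μ : Measure X} [SigmaFinite μ] {D : ℕ}

theorem coeFn_spinNBody (M : Matrix (Fin D) (Fin D) ℂ) {n : ℕ} (ψ : NBody μ D n) :
    spinNBody μ M n ψ =ᵐ[Measure.pi (fun _ : Fin n => μ)]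
      fun k => Matrix.toEuclideanCLM (n := Fin D) (𝕜 := ℂ) M (ψ k) :=
  ContinuousLinearMap.coeFn_compLpL _ _

theorem coe_spinSector (M : Matrix (Fin D) (Fin D) ℂ) {n : ℕ} (ψ : Sector μ D n) :
    (spinSector μ M n ψ : NBody μ D n) = spinNBody μ M n ψ := rfl

theorem spinNBody_mul (M M' : Matrix (Fin D) (Fin D) ℂ) {n : ℕ} (ψ : NBody μ D n) :
    spinNBody μ (M * M') n ψ = spinNBody μ M n (spinNBody μ M' n ψ) := by
  refine Lp.ext ?_
  filter_upwards [coeFn_spinNBody (M * M') ψ, coeFn_spinNBody M' ψ,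
    coeFn_spinNBody M (spinNBody μ M' n ψ)] with k h1 h2 h3
  rw [h1, h3, h2, map_mul]
  rfl

theorem inner_spinNBody_left (M : Matrix (Fin D) (Fin D) ℂ) {n : ℕ} (ψ φ : NBody μ D n) :
    ⟪spinNBody μ M n ψ, φ⟫_ℂ = ⟪ψ, spinNBody μ M.conjTranspose n φ⟫_ℂ := by
  rw [L2.inner_def, L2.inner_def]
  refine integral_congr_ae ?_
  filter_upwards [coeFn_spinNBody M ψ, coeFn_spinNBody M.conjTranspose φ] with k h1 h2
  rw [h1, h2, ← Matrix.star_eq_conjTranspose, map_star, ContinuousLinearMap.star_eq_adjoint,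
    ContinuousLinearMap.adjoint_inner_right]

theorem spinNBody_permute (M : Matrix (Fin D) (Fin D) ℂ) {n : ℕ} (σ : Equiv.Perm (Fin n))
    (ψ : NBody μ D n) :
    spinNBody μ M n (permute μ D σ ψ) = permute μ D σ (spinNBody μ M n ψ) := by
  refine Lp.ext ?_
  filter_upwards [coeFn_spinNBody M (permute μ D σ ψ), coeFn_permute σ ψ,
    coeFn_permute σ (spinNBody μ M n ψ),
    (measurePreserving_perm μ σ).quasiMeasurePreserving.ae (coeFn_spinNBody M ψ)]
    with k h1 h2 h3 h4
  rw [h1, h2, h3, h4]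

theorem spinNBody_average (M : Matrix (Fin D) (Fin D) ℂ) {n : ℕ} (ψ : NBody μ D n) :
    spinNBody μ M n (average μ D n ψ) = average μ D n (spinNBody μ M n ψ) := by
  simp only [average_apply, map_smul, map_sum, spinNBody_permute]

theorem spinNBody_tensor (M : Matrix (Fin D) (Fin D) ℂ) {n : ℕ} (f : Lp ℂ 2 μ)
    (ψ : NBody μ D n) :
    spinNBody μ M (n + 1) (tensor f ψ) = tensor f (spinNBody μ M n ψ) := by
  refine Lp.ext ?_
  filter_upwards [coeFn_spinNBody M (tensor f ψ), coeFn_tensor f ψ,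
    coeFn_tensor f (spinNBody μ M n ψ), ae_tail (coeFn_spinNBody M ψ)] with k h1 h2 h3 h4
  rw [h1, h2, h3, h4, map_smul]

theorem spinSector_mul (M M' : Matrix (Fin D) (Fin D) ℂ) {n : ℕ} (ψ : Sector μ D n) :
    spinSector μ (M * M') n ψ = spinSector μ M n (spinSector μ M' n ψ) :=
  Subtype.ext (spinNBody_mul M M' _)

theorem inner_spinSector_left (M : Matrix (Fin D) (Fin D) ℂ) {n : ℕ} (ψ φ : Sector μ D n) :
    ⟪spinSector μ M n ψ, φ⟫_ℂ = ⟪ψ, spinSector μ M.conjTranspose n φ⟫_ℂ :=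
  inner_spinNBody_left M _ _

theorem spinSector_createSector (M : Matrix (Fin D) (Fin D) ℂ) (f : Lp ℂ 2 μ) {n : ℕ}
    (ψ : Sector μ D n) :
    spinSector μ M (n + 1) (createSector D f n ψ) = createSector D f n (spinSector μ M n ψ) := by
  refine Subtype.ext ?_
  rw [coe_spinSector, coe_createSector, coe_createSector, coe_spinSector, map_smul,
    spinNBody_average, spinNBody_tensor]

/-- The adjoint of `spinSector_createSector` for the conjugate transpose of `M`. -/
theorem spinSector_annihilateSector (M : Matrix (Fin D) (Fin D) ℂ) (f : Lp ℂ 2 μ) {n : ℕ}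
    (ψ : Sector μ D (n + 1)) :
    spinSector μ M n (annihilateSector D f n ψ) =
      annihilateSector D f n (spinSector μ M (n + 1) ψ) := by
  refine ext_inner_left ℂ fun χ => ?_
  have h : ∀ {n : ℕ} (χ ψ : Sector μ D n), ⟪χ, spinSector μ M n ψ⟫_ℂ =
      ⟪spinSector μ M.conjTranspose n χ, ψ⟫_ℂ := fun χ ψ => by
    rw [inner_spinSector_left, Matrix.conjTranspose_conjTranspose]
  rw [h, annihilateSector, ContinuousLinearMap.adjoint_inner_right,
    ContinuousLinearMap.adjoint_inner_right, h, spinSector_createSector]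

theorem spinSector_vacuumSector (M : Matrix (Fin D) (Fin D) ℂ) (v : EuclideanSpace ℂ (Fin D)) :
    spinSector μ M 0 (vacuumSector μ v) =
      vacuumSector μ (Matrix.toEuclideanCLM (n := Fin D) (𝕜 := ℂ) M v) := by
  refine Subtype.ext (Lp.ext ?_)
  filter_upwards [coeFn_spinNBody M (vacuumSector μ v : NBody μ D 0), coeFn_vacuumSector (μ := μ) v,
    coeFn_vacuumSector (μ := μ) (Matrix.toEuclideanCLM (n := Fin D) (𝕜 := ℂ) M v)] with k h1 h2 h3
  rw [coe_spinSector, h1, h2, h3]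

end SpinSector

/-! ### Operator identities on arbitrary sequences of components -/

section FormalAlgebra

variable {X : Type*} [MeasurableSpace X] {μ : Measure X} [SigmaFinite μ] {D N : ℕ}

theorem createFormal_zero (f : Lp ℂ 2 μ) (Ψ : FormalFock μ D) : createFormal D f Ψ 0 = 0 := rfl

theorem createFormal_succ (f : Lp ℂ 2 μ) (Ψ : FormalFock μ D) (n : ℕ) :
    createFormal D f Ψ (n + 1) = createSector D f n (Ψ n) := rfl

theorem annihilateFormal_apply (f : Lp ℂ 2 μ) (Ψ : FormalFock μ D) (n : ℕ) :
    annihilateFormal D f Ψ n = annihilateSector D f n (Ψ (n + 1)) := rfl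

theorem spinFormal_apply (M : Matrix (Fin D) (Fin D) ℂ) (Ψ : FormalFock μ D) (n : ℕ) :
    spinFormal μ M Ψ n = spinSector μ M n (Ψ n) := rfl

theorem createFormal_add (f g : Lp ℂ 2 μ) (Ψ : FormalFock μ D) :
    createFormal D (f + g) Ψ = createFormal D f Ψ + createFormal D g Ψ := by
  funext n
  cases n with
  | zero => simp [createFormal_zero]
  | succ n => rw [Pi.add_apply]; simp only [createFormal_succ, createSector_add, add_apply]

theorem createFormal_smul (c : ℂ) (f : Lp ℂ 2 μ) (Ψ : FormalFock μ D) :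
    createFormal D (c • f) Ψ = c • createFormal D f Ψ := by
  funext n
  cases n with
  | zero => simp [createFormal_zero]
  | succ n => rw [Pi.smul_apply]; simp only [createFormal_succ, createSector_smul, smul_apply]

theorem createFormal_comm (f g : Lp ℂ 2 μ) (Ψ : FormalFock μ D) :
    createFormal D f (createFormal D g Ψ) = createFormal D g (createFormal D f Ψ) := by
  funext n
  rcases n with _ | _ | n
  · rfl
  · simp only [createFormal_succ, createFormal_zero, map_zero]
  · simp only [createFormal_succ, createSector_comm f g]

theorem annihilateFormal_createFormal (h f : Lp ℂ 2 μ) (Ψ : FormalFock μ D) :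
    annihilateFormal D h (createFormal D f Ψ) =
      createFormal D f (annihilateFormal D h Ψ) + ⟪h, f⟫_ℂ • Ψ := by
  funext n
  rw [Pi.add_apply, Pi.smul_apply]
  cases n with
  | zero =>
    rw [annihilateFormal_apply, createFormal_succ, createFormal_zero,
      annihilateSector_createSector_zero, zero_add]
  | succ n =>
    rw [annihilateFormal_apply, createFormal_succ, createFormal_succ, annihilateFormal_apply,
      annihilateSector_createSector_succ]

theorem spinFormal_createFormal (M : Matrix (Fin D) (Fin D) ℂ) (f : Lp ℂ 2 μ)
    (Ψ : FormalFock μ D) :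
    spinFormal μ M (createFormal D f Ψ) = createFormal D f (spinFormal μ M Ψ) := by
  funext n
  cases n with
  | zero => rw [spinFormal_apply, createFormal_zero, createFormal_zero, map_zero]
  | succ n =>
    rw [spinFormal_apply, createFormal_succ, createFormal_succ, spinSector_createSector]
    rfl

theorem spinFormal_annihilateFormal (M : Matrix (Fin D) (Fin D) ℂ) (f : Lp ℂ 2 μ)
    (Ψ : FormalFock μ D) :
    spinFormal μ M (annihilateFormal D f Ψ) = annihilateFormal D f (spinFormal μ M Ψ) := by
  funext n
  exact spinSector_annihilateSector M f _

theorem spinFormal_comm {M M' : Matrix (Fin D) (Fin D) ℂ} (h : Commute M M')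
    (Ψ : FormalFock μ D) :
    spinFormal μ M (spinFormal μ M' Ψ) = spinFormal μ M' (spinFormal μ M Ψ) := by
  funext n
  simp only [spinFormal_apply, ← spinSector_mul, h.eq]

theorem dressingGenerator_apply (B : Fin N → Matrix (Fin D) (Fin D) ℂ) (g : Fin N → Lp ℂ 2 μ)
    (Ψ : FormalFock μ D) :
    dressingGenerator B g Ψ = -∑ j, spinFormal μ (B j) (createFormal D (g j) Ψ) := by
  simp [dressingGenerator]

theorem dressingGenerator_apply_succ (B : Fin N → Matrix (Fin D) (Fin D) ℂ)
    (g : Fin N → Lp ℂ 2 μ) (Ψ : FormalFock μ D) (n : ℕ) :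
    dressingGenerator B g Ψ (n + 1) =
      -∑ j, spinSector μ (B j) (n + 1) (createSector D (g j) n (Ψ n)) := by
  simp [dressingGenerator_apply, spinFormal_apply, createFormal_succ]

/-- The shift `∑ⱼ ⟨h, gⱼ⟩ Bⱼ` of the displaced annihilation operator. -/
def shiftFormal (B : Fin N → Matrix (Fin D) (Fin D) ℂ) (g : Fin N → Lp ℂ 2 μ) (h : Lp ℂ 2 μ) :
    FormalFock μ D →ₗ[ℂ] FormalFock μ D :=
  ∑ j, ⟪h, g j⟫_ℂ • spinFormal μ (B j)

theorem shiftFormal_apply (B : Fin N → Matrix (Fin D) (Fin D) ℂ) (g : Fin N → Lp ℂ 2 μ)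
    (h : Lp ℂ 2 μ) (Ψ : FormalFock μ D) :
    shiftFormal B g h Ψ = ∑ j, ⟪h, g j⟫_ℂ • spinFormal μ (B j) Ψ := by
  simp [shiftFormal]

theorem shiftFormal_createFormal (B : Fin N → Matrix (Fin D) (Fin D) ℂ) (g : Fin N → Lp ℂ 2 μ)
    (h f : Lp ℂ 2 μ) (Ψ : FormalFock μ D) :
    shiftFormal B g h (createFormal D f Ψ) = createFormal D f (shiftFormal B g h Ψ) := by
  simp only [shiftFormal_apply, map_sum, map_smul, spinFormal_createFormal]

theorem spinFormal_dressingGenerator {B : Fin N → Matrix (Fin D) (Fin D) ℂ}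
    {M : Matrix (Fin D) (Fin D) ℂ} (hM : ∀ j, Commute M (B j)) (g : Fin N → Lp ℂ 2 μ)
    (Ψ : FormalFock μ D) :
    spinFormal μ M (dressingGenerator B g Ψ) = dressingGenerator B g (spinFormal μ M Ψ) := by
  simp only [dressingGenerator_apply, map_neg, map_sum, spinFormal_comm (hM _),
    spinFormal_createFormal]

theorem spinFormal_dressingGenerator_pow {B : Fin N → Matrix (Fin D) (Fin D) ℂ}
    {M : Matrix (Fin D) (Fin D) ℂ} (hM : ∀ j, Commute M (B j)) (g : Fin N → Lp ℂ 2 μ)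
    (Ψ : FormalFock μ D) (n : ℕ) :
    spinFormal μ M ((dressingGenerator B g ^ n) Ψ) =
      (dressingGenerator B g ^ n) (spinFormal μ M Ψ) := by
  induction n with
  | zero => rfl
  | succ n ih =>
    rw [pow_succ', Module.End.mul_apply, spinFormal_dressingGenerator hM, ih, Module.End.mul_apply]

theorem shiftFormal_dressingGenerator {B : Fin N → Matrix (Fin D) (Fin D) ℂ}
    (hB : ∀ j j', Commute (B j) (B j')) (g : Fin N → Lp ℂ 2 μ) (h : Lp ℂ 2 μ)
    (Ψ : FormalFock μ D) :
    shiftFormal B g h (dressingGenerator B g Ψ) = dressingGenerator B g (shiftFormal B g h Ψ) := by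
  simp only [shiftFormal_apply, map_sum, map_smul, spinFormal_dressingGenerator (hB _)]

/-- The commutation relation for each `a*(gⱼ)`: the commutator of `a(h)` with `G` is minus the shift
that turns `a(h)` into `â(h)`. -/
theorem annihilateFormal_dressingGenerator (B : Fin N → Matrix (Fin D) (Fin D) ℂ)
    (g : Fin N → Lp ℂ 2 μ) (h : Lp ℂ 2 μ) (Ψ : FormalFock μ D) :
    annihilateFormal D h (dressingGenerator B g Ψ) =
      dressingGenerator B g (annihilateFormal D h Ψ) - shiftFormal B g h Ψ := by
  simp only [dressingGenerator_apply, shiftFormal_apply, map_neg, map_sum,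
    ← spinFormal_annihilateFormal, annihilateFormal_createFormal, map_add, map_smul,
    Finset.sum_add_distrib]
  abel

variable (μ) in
/-- The sequence of components of `v ⊗ Ω`. -/
def vacuumFormal (v : EuclideanSpace ℂ (Fin D)) : FormalFock μ D := fun n => vacuum μ v n

theorem vacuumFormal_succ (v : EuclideanSpace ℂ (Fin D)) (n : ℕ) :
    vacuumFormal μ v (n + 1) = 0 := by
  rw [vacuumFormal, vacuum, lp.single_apply_ne _ _ _ (Nat.succ_ne_zero n)]

theorem vacuumFormal_zero (v : EuclideanSpace ℂ (Fin D)) :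
    vacuumFormal μ v 0 = vacuumSector μ v := rfl

theorem annihilateFormal_vacuumFormal (h : Lp ℂ 2 μ) (v : EuclideanSpace ℂ (Fin D)) :
    annihilateFormal D h (vacuumFormal μ v) = 0 := by
  funext n
  rw [annihilateFormal_apply, vacuumFormal_succ, map_zero, Pi.zero_apply]

theorem spinFormal_vacuumFormal (M : Matrix (Fin D) (Fin D) ℂ) (v : EuclideanSpace ℂ (Fin D)) :
    spinFormal μ M (vacuumFormal μ v) =
      vacuumFormal μ (Matrix.toEuclideanCLM (n := Fin D) (𝕜 := ℂ) M v) := by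
  funext n
  cases n with
  | zero => exact spinSector_vacuumSector M v
  | succ n => rw [spinFormal_apply, vacuumFormal_succ, vacuumFormal_succ, map_zero]

/-- Since `[a(h), G]` commutes with `G`, the operator `a(h)` acts on powers of `G` as a derivative,
with no boundary term as `a(h)` kills the vacuum. -/
theorem annihilateFormal_dressingGenerator_pow_vacuumFormal
    {B : Fin N → Matrix (Fin D) (Fin D) ℂ} (hB : ∀ j j', Commute (B j) (B j'))
    (g : Fin N → Lp ℂ 2 μ) (h : Lp ℂ 2 μ) (v : EuclideanSpace ℂ (Fin D)) (n : ℕ) :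
    annihilateFormal D h ((dressingGenerator B g ^ (n + 1)) (vacuumFormal μ v)) =
      -((n + 1 : ℂ) • shiftFormal B g h ((dressingGenerator B g ^ n) (vacuumFormal μ v))) := by
  induction n with
  | zero =>
    simp [annihilateFormal_dressingGenerator, annihilateFormal_vacuumFormal]
  | succ n ih =>
    rw [pow_succ', Module.End.mul_apply, annihilateFormal_dressingGenerator, ih, map_neg, map_smul,
      ← shiftFormal_dressingGenerator hB, ← Module.End.mul_apply (dressingGenerator B g),
      ← pow_succ']
    push_cast
    module

theorem dressingGenerator_pow_vacuumFormal_apply_of_lt (B : Fin N → Matrix (Fin D) (Fin D) ℂ)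
    (g : Fin N → Lp ℂ 2 μ) (v : EuclideanSpace ℂ (Fin D)) {n m : ℕ} (h : n < m) :
    (dressingGenerator B g ^ n) (vacuumFormal μ v) m = 0 := by
  obtain ⟨m, rfl⟩ : ∃ k, m = k + 1 := ⟨m - 1, by omega⟩
  induction n generalizing m with
  | zero => exact vacuumFormal_succ v m
  | succ n ih =>
    obtain ⟨m, rfl⟩ : ∃ k, m = k + 1 := ⟨m - 1, by omega⟩
    rw [pow_succ', Module.End.mul_apply, dressingGenerator_apply_succ, ih m (by omega)]
    simp

/-- The sequence of components of `T (v ⊗ Ω)`. -/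
def dressedVacuum (B : Fin N → Matrix (Fin D) (Fin D) ℂ) (g : Fin N → Lp ℂ 2 μ)
    (v : EuclideanSpace ℂ (Fin D)) : FormalFock μ D :=
  dressingFormal B g (vacuumFormal μ v)

/-- `Gⁿ (v ⊗ Ω)` has exactly `n` bosons, so a single term of the exponential series reaches each
component. -/
theorem dressedVacuum_apply (B : Fin N → Matrix (Fin D) (Fin D) ℂ) (g : Fin N → Lp ℂ 2 μ)
    (v : EuclideanSpace ℂ (Fin D)) (m : ℕ) :
    dressedVacuum B g v m =
      ((m.factorial : ℂ)⁻¹) • (dressingGenerator B g ^ m) (vacuumFormal μ v) m := by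
  have h : dressedVacuum B g v m = ∑ n ∈ Finset.range (m + 1),
      ((n.factorial : ℂ)⁻¹) • (dressingGenerator B g ^ n) (vacuumFormal μ v) m := by
    simp [dressedVacuum, dressingFormal]
  rw [h, Finset.sum_range_succ, Finset.sum_eq_zero, zero_add]
  intro n hn
  rw [dressingGenerator_pow_vacuumFormal_apply_of_lt B g v (Finset.mem_range.1 hn), smul_zero]

/-- The derivative factor turns `1 / (m+1)!` into `1 / m!`, so `a(h)` reproduces the exponential
series up to the shift, as for a coherent state. -/
theorem annihilateFormal_dressedVacuum {B : Fin N → Matrix (Fin D) (Fin D) ℂ}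
    (hB : ∀ j j', Commute (B j) (B j')) (g : Fin N → Lp ℂ 2 μ) (h : Lp ℂ 2 μ)
    (v : EuclideanSpace ℂ (Fin D)) :
    annihilateFormal D h (dressedVacuum B g v) = -shiftFormal B g h (dressedVacuum B g v) := by
  funext m
  have h1 := congrFun (annihilateFormal_dressingGenerator_pow_vacuumFormal hB g h v m) m
  rw [annihilateFormal_apply] at h1
  have hne : (m + 1 : ℂ) ≠ 0 := by exact_mod_cast m.succ_ne_zero
  rw [annihilateFormal_apply, dressedVacuum_apply, map_smul, h1, Pi.neg_apply, Pi.neg_apply,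
    Pi.smul_apply, smul_neg, smul_smul, Nat.factorial_succ, Nat.cast_mul, mul_inv, Nat.cast_succ,
    mul_right_comm, inv_mul_cancel₀ hne, one_mul]
  simp only [shiftFormal_apply, Finset.sum_apply, Pi.smul_apply, spinFormal_apply,
    dressedVacuum_apply, map_smul, Finset.smul_sum, smul_comm ((m.factorial : ℂ)⁻¹)]

/-- Used with `M = Bⱼ`: the matrices in `G` can be absorbed into the vector `v`, so applying `G`
does not leave the span of dressed vectors. -/
theorem spinFormal_dressedVacuum {B : Fin N → Matrix (Fin D) (Fin D) ℂ}
    {M : Matrix (Fin D) (Fin D) ℂ} (hM : ∀ j, Commute M (B j)) (g : Fin N → Lp ℂ 2 μ)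
    (v : EuclideanSpace ℂ (Fin D)) :
    spinFormal μ M (dressedVacuum B g v) =
      dressedVacuum B g (Matrix.toEuclideanCLM (n := Fin D) (𝕜 := ℂ) M v) := by
  funext m
  rw [spinFormal_apply, dressedVacuum_apply, dressedVacuum_apply, map_smul, ← spinFormal_apply,
    spinFormal_dressingGenerator_pow hM, spinFormal_vacuumFormal]

/-- `a*(h₁) ⋯ a*(hₙ)` on sequences of components. -/
def createList (D : ℕ) : List (Lp ℂ 2 μ) → FormalFock μ D →ₗ[ℂ] FormalFock μ D
  | [] => LinearMap.id
  | h :: hs => createFormal D h ∘ₗ createList D hs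

theorem createList_nil (Ψ : FormalFock μ D) : createList D [] Ψ = Ψ := rfl

theorem createList_cons (h : Lp ℂ 2 μ) (hs : List (Lp ℂ 2 μ)) (Ψ : FormalFock μ D) :
    createList D (h :: hs) Ψ = createFormal D h (createList D hs Ψ) := rfl

theorem spinFormal_createList (M : Matrix (Fin D) (Fin D) ℂ) (hs : List (Lp ℂ 2 μ))
    (Ψ : FormalFock μ D) :
    spinFormal μ M (createList D hs Ψ) = createList D hs (spinFormal μ M Ψ) := by
  induction hs with
  | nil => rfl
  | cons h' hs ih => rw [createList_cons, spinFormal_createFormal, ih, createList_cons]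

theorem createFormal_single (h : Lp ℂ 2 μ) (n : ℕ) (ψ : Sector μ D n) :
    createFormal D h (Pi.single n ψ) = Pi.single (n + 1) (createSector D h n ψ) := by
  funext m
  cases m with
  | zero => rw [createFormal_zero, Pi.single_eq_of_ne (by omega)]
  | succ m =>
    rw [createFormal_succ]
    rcases eq_or_ne m n with rfl | hmn
    · rw [Pi.single_eq_same, Pi.single_eq_same]
    · rw [Pi.single_eq_of_ne hmn, Pi.single_eq_of_ne (by omega), map_zero]

theorem createList_vacuumFormal (v : EuclideanSpace ℂ (Fin D)) {n : ℕ} (f : Fin n → Lp ℂ 2 μ) :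
    createList D (List.ofFn f) (vacuumFormal μ v) = Pi.single n (productVector μ v f) := by
  induction n with
  | zero =>
    funext m
    rw [List.ofFn_zero, createList_nil]
    cases m with
    | zero => rw [Pi.single_eq_same]; rfl
    | succ m => rw [vacuumFormal_succ, Pi.single_eq_of_ne (by omega)]
  | succ n ih =>
    rw [List.ofFn_succ, createList_cons, ih (fun i => f i.succ), createFormal_single]
    rfl

end FormalAlgebra

/-! ### Faster than geometric decay in the boson number -/

section Rapid

variable {X : Type*} [MeasurableSpace X] {μ : Measure X} [SigmaFinite μ] {D N : ℕ}

/-- A family of sequences of components whose norms decrease faster than any geometric sequence,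
uniformly in the family. -/
def UniformlyRapid {κ : Type*} (Ψ : κ → FormalFock μ D) : Prop :=
  ∀ r : ℝ, 0 < r → ∃ C : ℝ, ∀ i n, r ^ n * ‖Ψ i n‖ ≤ C

theorem UniformlyRapid.add {κ : Type*} {Ψ Φ : κ → FormalFock μ D} (hΨ : UniformlyRapid Ψ)
    (hΦ : UniformlyRapid Φ) : UniformlyRapid fun i => Ψ i + Φ i := by
  intro r hr
  obtain ⟨C, hC⟩ := hΨ r hr
  obtain ⟨C', hC'⟩ := hΦ r hr
  refine ⟨C + C', fun i n => ?_⟩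
  calc r ^ n * ‖Ψ i n + Φ i n‖ ≤ r ^ n * (‖Ψ i n‖ + ‖Φ i n‖) := by gcongr; exact norm_add_le _ _
    _ = r ^ n * ‖Ψ i n‖ + r ^ n * ‖Φ i n‖ := mul_add _ _ _
    _ ≤ C + C' := add_le_add (hC i n) (hC' i n)

theorem UniformlyRapid.const_smul {κ : Type*} {Ψ : κ → FormalFock μ D} (hΨ : UniformlyRapid Ψ)
    (c : ℂ) : UniformlyRapid fun i => c • Ψ i := by
  intro r hr
  obtain ⟨C, hC⟩ := hΨ r hr
  refine ⟨‖c‖ * C, fun i n => ?_⟩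
  calc r ^ n * ‖c • Ψ i n‖ = ‖c‖ * (r ^ n * ‖Ψ i n‖) := by rw [norm_smul]; ring
    _ ≤ ‖c‖ * C := by gcongr; exact hC i n

theorem norm_createSector_apply_le (f : Lp ℂ 2 μ) {n : ℕ} (ψ : Sector μ D n) :
    ‖createSector D f n ψ‖ ≤ Real.sqrt (n + 1) * ‖f‖ * ‖ψ‖ :=
  (createSector D f n).le_of_opNorm_le (norm_createSector_le f n) ψ

/-- The growth `√(n+1) ≤ 2 ^ n` is paid for by doubling the rate `r`, which is possible because
decay is assumed at every rate. -/
theorem UniformlyRapid.createFormal {κ : Type*} {Ψ : κ → FormalFock μ D} (hΨ : UniformlyRapid Ψ)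
    (f : Lp ℂ 2 μ) : UniformlyRapid fun i => createFormal D f (Ψ i) := by
  intro r hr
  obtain ⟨C, hC⟩ := hΨ (2 * r) (by positivity)
  refine ⟨max 0 (r * ‖f‖ * C), fun i n => ?_⟩
  cases n with
  | zero => simp [createFormal_zero]
  | succ n =>
    refine le_trans ?_ (le_max_right _ _)
    have h2 : Real.sqrt (n + 1) ≤ 2 ^ n := by
      rw [Real.sqrt_le_left (by positivity)]
      have h3 : (n + 1 : ℝ) ≤ 2 ^ n := by exact_mod_cast Nat.lt_two_pow_self
      nlinarith [one_le_pow₀ (one_le_two : (1 : ℝ) ≤ 2) (n := n)]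
    calc r ^ (n + 1) * ‖createSector D f n (Ψ i n)‖
        ≤ r ^ (n + 1) * (2 ^ n * ‖f‖ * ‖Ψ i n‖) := by
          gcongr
          exact (norm_createSector_apply_le f _).trans (by gcongr)
      _ = r * ‖f‖ * ((2 * r) ^ n * ‖Ψ i n‖) := by rw [mul_pow]; ring
      _ ≤ r * ‖f‖ * C := by gcongr; exact hC i n

/-- A uniformly rapid family is dominated by a geometric sequence. -/
theorem UniformlyRapid.exists_bound {κ : Type*} {Ψ : κ → FormalFock μ D}
    (hΨ : UniformlyRapid Ψ) :
    ∃ C : ℝ, 0 ≤ C ∧ ∀ i (n : ℕ), ((n : ℝ) + 1) * ‖Ψ i n‖ ^ 2 ≤ C * (1 / 2) ^ n := by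
  -- Rate `2` gives `‖Ψ i n‖ ^ 2 ≤ C ^ 2 / 4 ^ n`; one factor `2 ^ n` absorbs `n + 1`, the other
  -- leaves a summable series.
  obtain ⟨C, hC⟩ := hΨ 2 two_pos
  refine ⟨C ^ 2, sq_nonneg _, fun i n => ?_⟩
  have h1 : (n + 1 : ℝ) ≤ 2 ^ n := by exact_mod_cast Nat.lt_two_pow_self
  have h2 : (2 ^ n * ‖Ψ i n‖) ^ 2 ≤ C ^ 2 := by gcongr; exact hC i n
  rw [one_div, inv_pow, ← div_eq_mul_inv, le_div_iff₀ (by positivity)]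
  calc ((n : ℝ) + 1) * ‖Ψ i n‖ ^ 2 * 2 ^ n ≤ 2 ^ n * ‖Ψ i n‖ ^ 2 * 2 ^ n := by gcongr
    _ = (2 ^ n * ‖Ψ i n‖) ^ 2 := by ring
    _ ≤ C ^ 2 := h2

variable (μ D) in
/-- The sequences of components whose norms decrease faster than any geometric sequence. -/
def rapid : Submodule ℂ (FormalFock μ D) where
  carrier := {Ψ | UniformlyRapid fun _ : Unit => Ψ}
  zero_mem' := fun r _ => ⟨0, fun _ n => by simp⟩
  add_mem' hΨ hΦ := hΨ.add hΦ
  smul_mem' c _ hΨ := hΨ.const_smul c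

theorem UniformlyRapid.mem_rapid {κ : Type*} {Ψ : κ → FormalFock μ D} (hΨ : UniformlyRapid Ψ)
    (i : κ) : Ψ i ∈ rapid μ D := fun r hr =>
  (hΨ r hr).imp fun _ hC _ n => hC i n

theorem createFormal_mem_rapid (f : Lp ℂ 2 μ) {Ψ : FormalFock μ D} (hΨ : Ψ ∈ rapid μ D) :
    createFormal D f Ψ ∈ rapid μ D := UniformlyRapid.createFormal hΨ f

theorem createList_mem_rapid (hs : List (Lp ℂ 2 μ)) {Ψ : FormalFock μ D} (hΨ : Ψ ∈ rapid μ D) :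
    createList D hs Ψ ∈ rapid μ D := by
  induction hs with
  | nil => exact hΨ
  | cons h hs ih => exact createFormal_mem_rapid h ih

theorem summable_of_mem_rapid {Ψ : FormalFock μ D} (hΨ : Ψ ∈ rapid μ D) :
    Summable fun n : ℕ => ((n : ℝ) + 1) * ‖Ψ n‖ ^ 2 := by
  obtain ⟨C, -, hC⟩ := UniformlyRapid.exists_bound hΨ
  exact Summable.of_nonneg_of_le (fun n => by positivity) (hC ())
    (summable_geometric_two.mul_left C)

theorem memℓp_of_mem_rapid {Ψ : FormalFock μ D} (hΨ : Ψ ∈ rapid μ D) : Memℓp Ψ 2 :=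
  memℓp_two <| Summable.of_nonneg_of_le (fun n => by positivity)
    (fun n => le_mul_of_one_le_left (sq_nonneg _) (by simp)) (summable_of_mem_rapid hΨ)

variable (μ D) in
/-- Rapidly decreasing sequences of components as vectors of `ℂ^D ⊗ 𝓕`. -/
def ofRapid : rapid μ D →ₗ[ℂ] Fock μ D where
  toFun Ψ := ⟨fun n => (Ψ : FormalFock μ D) n, memℓp_of_mem_rapid Ψ.2⟩
  map_add' _ _ := rfl
  map_smul' _ _ := rfl

theorem ofRapid_apply (Ψ : rapid μ D) (n : ℕ) : ofRapid μ D Ψ n = (Ψ : FormalFock μ D) n := rfl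

theorem ofRapid_mem_numberHalfDomain (Ψ : rapid μ D) : ofRapid μ D Ψ ∈ numberHalfDomain μ D :=
  Summable.of_nonneg_of_le (fun n => by positivity)
    (fun n => by rw [ofRapid_apply]; gcongr; linarith) (summable_of_mem_rapid Ψ.2)

/-- Dominated convergence in `ℂ^D ⊗ 𝓕`. -/
theorem UniformlyRapid.tendsto_ofRapid {Ψ : ℕ → FormalFock μ D} (hΨ : UniformlyRapid Ψ)
    {Φ : FormalFock μ D} (hΦ : Φ ∈ rapid μ D) (h : ∀ m, ∀ᶠ M in atTop, Ψ M m = Φ m) :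
    Tendsto (fun M => ofRapid μ D ⟨Ψ M, hΨ.mem_rapid M⟩) atTop (𝓝 (ofRapid μ D ⟨Φ, hΦ⟩)) := by
  have hdiff : UniformlyRapid fun M => Ψ M + (-1 : ℂ) • Φ :=
    hΨ.add (UniformlyRapid.const_smul (fun r hr => (hΦ r hr).imp fun _ hC _ n => hC () n) _)
  obtain ⟨C, hC0, hC⟩ := hdiff.exists_bound
  rw [tendsto_iff_norm_sub_tendsto_zero]
  have hsq : Tendsto (fun M => ‖ofRapid μ D ⟨Ψ M, hΨ.mem_rapid M⟩ - ofRapid μ D ⟨Φ, hΦ⟩‖ ^ 2)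
      atTop (𝓝 0) := by
    have h1 : Tendsto (fun M => ∑' m, ‖Ψ M m - Φ m‖ ^ 2) atTop (𝓝 (∑' _ : ℕ, (0 : ℝ))) := by
      refine tendsto_tsum_of_dominated_convergence (summable_geometric_two.mul_left C)
        (fun m => ?_) (Eventually.of_forall fun M m => ?_)
      · refine tendsto_const_nhds.congr' ?_
        filter_upwards [h m] with M hM
        rw [hM, sub_self, norm_zero, zero_pow two_ne_zero]
      · rw [Real.norm_of_nonneg (sq_nonneg _)]
        refine le_trans ?_ (hC M m)
        have : Ψ M m - Φ m = (Ψ M + (-1 : ℂ) • Φ) m := by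
          rw [Pi.add_apply, Pi.smul_apply, neg_one_smul, sub_eq_add_neg]
        rw [this]
        exact le_mul_of_one_le_left (sq_nonneg _) (by simp)
    rw [tsum_zero] at h1
    refine h1.congr fun M => ?_
    have h2 := lp.norm_rpow_eq_tsum (p := 2) (by norm_num)
      (ofRapid μ D ⟨Ψ M, hΨ.mem_rapid M⟩ - ofRapid μ D ⟨Φ, hΦ⟩)
    simp only [ENNReal.toReal_ofNat, Real.rpow_two] at h2
    exact h2.symm
  have h3 := hsq.sqrt
  rw [Real.sqrt_zero] at h3
  exact h3.congr fun M => Real.sqrt_sq (norm_nonneg _)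

theorem vacuumFormal_mem_rapid (v : EuclideanSpace ℂ (Fin D)) : vacuumFormal μ v ∈ rapid μ D :=
  fun r hr => ⟨‖vacuumSector μ v‖, fun _ n => by
    cases n with
    | zero => simp [vacuumFormal_zero]
    | succ n => simp [vacuumFormal_succ]⟩

/-- The step from `n` to `n + 1` bosons costs at most `c √(n+1)`, and these roots multiply to
`√(n!)`. -/
theorem norm_dressingGenerator_pow_vacuumFormal_le (B : Fin N → Matrix (Fin D) (Fin D) ℂ)
    (g : Fin N → Lp ℂ 2 μ) (v : EuclideanSpace ℂ (Fin D)) (n : ℕ) :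
    ‖(dressingGenerator B g ^ n) (vacuumFormal μ v) n‖ ≤
      (∑ j, ‖Matrix.toEuclideanCLM (n := Fin D) (𝕜 := ℂ) (B j)‖ * ‖g j‖) ^ n *
        Real.sqrt n.factorial * ‖vacuumSector μ v‖ := by
  set c := ∑ j, ‖Matrix.toEuclideanCLM (n := Fin D) (𝕜 := ℂ) (B j)‖ * ‖g j‖ with hc
  have hc0 : 0 ≤ c := Finset.sum_nonneg fun j _ => by positivity
  induction n with
  | zero => simp [vacuumFormal_zero]
  | succ n ih =>
    rw [pow_succ', Module.End.mul_apply, dressingGenerator_apply_succ, norm_neg]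
    set Φ := (dressingGenerator B g ^ n) (vacuumFormal μ v) n
    have h1 : ∀ j, ‖spinSector μ (B j) (n + 1) (createSector D (g j) n Φ)‖ ≤
        ‖Matrix.toEuclideanCLM (n := Fin D) (𝕜 := ℂ) (B j)‖ * ‖g j‖ *
          (Real.sqrt (n + 1) * ‖Φ‖) := by
      intro j
      calc _ ≤ ‖Matrix.toEuclideanCLM (n := Fin D) (𝕜 := ℂ) (B j)‖ *
            ‖createSector D (g j) n Φ‖ :=
            (spinSector μ (B j) (n + 1)).le_of_opNorm_le (norm_spinSector_le _ _) _
        _ ≤ ‖Matrix.toEuclideanCLM (n := Fin D) (𝕜 := ℂ) (B j)‖ *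
            (Real.sqrt (n + 1) * ‖g j‖ * ‖Φ‖) := by
            gcongr
            exact norm_createSector_apply_le _ _
        _ = _ := by ring
    have h2 : Real.sqrt ((n + 1).factorial : ℝ) = Real.sqrt (n + 1) * Real.sqrt n.factorial := by
      rw [← Real.sqrt_mul (by positivity), Nat.factorial_succ]
      push_cast
      rfl
    calc _ ≤ ∑ j, ‖Matrix.toEuclideanCLM (n := Fin D) (𝕜 := ℂ) (B j)‖ * ‖g j‖ *
          (Real.sqrt (n + 1) * ‖Φ‖) := (norm_sum_le _ _).trans (Finset.sum_le_sum fun j _ => h1 j)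
      _ = c * (Real.sqrt (n + 1) * ‖Φ‖) := by rw [← Finset.sum_mul]
      _ ≤ c * (Real.sqrt (n + 1) * (c ^ n * Real.sqrt n.factorial * ‖vacuumSector μ v‖)) := by
          gcongr
      _ = _ := by rw [h2]; ring

theorem dressedVacuum_mem_rapid (B : Fin N → Matrix (Fin D) (Fin D) ℂ) (g : Fin N → Lp ℂ 2 μ)
    (v : EuclideanSpace ℂ (Fin D)) : dressedVacuum B g v ∈ rapid μ D := by
  intro r hr
  set c := ∑ j, ‖Matrix.toEuclideanCLM (n := Fin D) (𝕜 := ℂ) (B j)‖ * ‖g j‖ with hc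
  have hc0 : 0 ≤ c := Finset.sum_nonneg fun j _ => by positivity
  refine ⟨Real.sqrt (Real.exp ((r * c) ^ 2)) * ‖vacuumSector μ v‖, fun _ n => ?_⟩
  have hn : (0 : ℝ) < n.factorial := by exact_mod_cast n.factorial_pos
  have h1 := norm_dressingGenerator_pow_vacuumFormal_le B g v n
  rw [← hc] at h1
  -- After division by `n!` the bound is `c ^ n / √(n!)`. Its square, weighted with `r ^ (2 n)`, is
  -- a term of the series of `exp ((r c) ^ 2)`.
  have h2 : (r * c) ^ n / Real.sqrt n.factorial ≤ Real.sqrt (Real.exp ((r * c) ^ 2)) := by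
    refine Real.le_sqrt_of_sq_le ?_
    rw [div_pow, Real.sq_sqrt hn.le, ← pow_mul, mul_comm n 2, pow_mul]
    exact Real.pow_div_factorial_le_exp _ (sq_nonneg _) n
  change r ^ n * ‖dressedVacuum B g v n‖ ≤ _
  rw [dressedVacuum_apply, norm_smul, norm_inv, Complex.norm_natCast]
  have h3 : (n.factorial : ℝ)⁻¹ * Real.sqrt n.factorial = (Real.sqrt n.factorial)⁻¹ := by
    rw [inv_mul_eq_div, Real.sqrt_div_self', one_div]
  calc r ^ n * ((n.factorial : ℝ)⁻¹ * ‖(dressingGenerator B g ^ n) (vacuumFormal μ v) n‖)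
      ≤ r ^ n * ((n.factorial : ℝ)⁻¹ *
          (c ^ n * Real.sqrt n.factorial * ‖vacuumSector μ v‖)) := by gcongr
    _ = (r * c) ^ n * ((n.factorial : ℝ)⁻¹ * Real.sqrt n.factorial) * ‖vacuumSector μ v‖ := by
        rw [mul_pow]; ring
    _ = (r * c) ^ n / Real.sqrt n.factorial * ‖vacuumSector μ v‖ := by
        rw [h3, div_eq_mul_inv]
    _ ≤ _ := by gcongr

end Rapid

/-! ### Dressed test vectors and their density -/

section TestVectors

variable {X : Type*} [MeasurableSpace X] {μ : Measure X} [SigmaFinite μ] {D N : ℕ}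

theorem mem_graph_ofFormal {A : FormalFock μ D →ₗ[ℂ] FormalFock μ D} {V : Submodule ℂ (Fock μ D)}
    {h : ∀ Ψ ∈ V, Memℓp (A (fun n => Ψ n)) 2} {Φ Ψ : Fock μ D} :
    (Φ, Ψ) ∈ (ofFormal A V h).graph ↔ Φ ∈ V ∧ (fun n => Ψ n) = A (fun n => Φ n) := by
  rw [LinearPMap.mem_graph_iff]
  constructor
  · rintro ⟨⟨χ, hχ⟩, h1, h2⟩
    simp only at h1 h2
    subst h1 h2
    exact ⟨hχ, rfl⟩
  · rintro ⟨h1, h2⟩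
    exact ⟨⟨Φ, h1⟩, rfl, Subtype.ext h2.symm⟩

/-- The sequence of components of `a*(h₁) ⋯ a*(hₙ) T (v ⊗ Ω)`. -/
def testVector (B : Fin N → Matrix (Fin D) (Fin D) ℂ) (g : Fin N → Lp ℂ 2 μ)
    (v : EuclideanSpace ℂ (Fin D)) (hs : List (Lp ℂ 2 μ)) : rapid μ D :=
  ⟨createList D hs (dressedVacuum B g v), createList_mem_rapid hs (dressedVacuum_mem_rapid B g v)⟩

theorem vacuum_mem_dressing_domain (B : Fin N → Matrix (Fin D) (Fin D) ℂ) (g : Fin N → Lp ℂ 2 μ)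
    (v : EuclideanSpace ℂ (Fin D)) : vacuum μ v ∈ (dressing B g).domain :=
  memℓp_of_mem_rapid (dressedVacuum_mem_rapid B g v)

/-- Rapid decay supplies all domain conditions, so the relation is the graph of an explicit function
of `v` and `ls`; existence and uniqueness of dressed vectors follow. -/
theorem isDressed_iff (B : Fin N → Matrix (Fin D) (Fin D) ℂ) (g : Fin N → Lp ℂ 2 μ) {ι : Type*}
    (e : ι → Lp ℂ 2 μ) (v : EuclideanSpace ℂ (Fin D)) (ls : List ι) (Ψ : Fock μ D) :
    IsDressed B g e v ls Ψ ↔ Ψ = ofRapid μ D (testVector B g v (ls.map e)) := by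
  induction ls generalizing Ψ with
  | nil =>
    refine (mem_graph_ofFormal (A := dressingFormal B g)).trans ?_
    constructor
    · rintro ⟨-, h⟩
      exact Subtype.ext h
    · rintro rfl
      exact ⟨vacuum_mem_dressing_domain B g v, rfl⟩
  | cons l ls ih =>
    simp only [IsDressed, ih, exists_eq_left, creation, mem_graph_ofFormal]
    constructor
    · rintro ⟨-, h⟩
      exact Subtype.ext h
    · rintro rfl
      exact ⟨ofRapid_mem_numberHalfDomain _, rfl⟩

theorem testDomain_eq_span (B : Fin N → Matrix (Fin D) (Fin D) ℂ) (g : Fin N → Lp ℂ 2 μ)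
    {ι : Type*} (e : ι → Lp ℂ 2 μ) :
    testDomain B g e = Submodule.span ℂ
      {Ψ | ∃ v ls, Ψ = ofRapid μ D (testVector B g v (List.map e ls))} := by
  simp only [testDomain, isDressed_iff]

theorem createList_append_cons (h : Lp ℂ 2 μ) (hs ks : List (Lp ℂ 2 μ)) (Ψ : FormalFock μ D) :
    createList D (hs ++ h :: ks) Ψ = createFormal D h (createList D (hs ++ ks) Ψ) := by
  induction hs with
  | nil => rfl
  | cons h' hs ih =>
    rw [List.cons_append, List.cons_append, createList_cons, createList_cons, ih,
      createFormal_comm]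

theorem norm_sq_eq_tsum (Ψ : Fock μ D) : ‖Ψ‖ ^ 2 = ∑' n, ‖Ψ n‖ ^ 2 := by
  have h := lp.norm_rpow_eq_tsum (p := 2) (by norm_num) Ψ
  simpa only [ENNReal.toReal_ofNat, Real.rpow_two] using h

theorem summable_of_mem_numberHalfDomain {Φ : Fock μ D} (hΦ : Φ ∈ numberHalfDomain μ D) :
    Summable fun n : ℕ => ((n : ℝ) + 1) * ‖Φ n‖ ^ 2 := by
  have h1 : Summable fun n : ℕ => (n : ℝ) * ‖Φ n‖ ^ 2 := hΦ
  refine (h1.add (summable_sq Φ)).congr fun n => ?_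
  ring

/-- This is `‖a*(f) Φ‖ ≤ ‖f‖ ‖(𝒩 + 1)^{1/2} Φ‖`. For fixed `Φ` it makes `f ↦ a*(f) Φ` continuous,
which drives both the density argument and the convergence of the series for `H`. -/
theorem norm_le_of_eq_createFormal {f : Lp ℂ 2 μ} {Φ Ψ : Fock μ D}
    (hΦ : Φ ∈ numberHalfDomain μ D) (hΨ : ∀ n, Ψ n = createFormal D f (fun n => Φ n) n) :
    ‖Ψ‖ ≤ Real.sqrt (∑' n : ℕ, ((n : ℝ) + 1) * ‖Φ n‖ ^ 2) * ‖f‖ := by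
  have hS0 : 0 ≤ ∑' n : ℕ, ((n : ℝ) + 1) * ‖Φ n‖ ^ 2 := tsum_nonneg fun n => by positivity
  have hsum := summable_sq Ψ
  have h0 : Ψ 0 = 0 := hΨ 0
  have hn : ∀ n : ℕ, ‖Ψ (n + 1)‖ ^ 2 ≤ ((n : ℝ) + 1) * ‖Φ n‖ ^ 2 * ‖f‖ ^ 2 := by
    intro n
    have h1 : ‖Ψ (n + 1)‖ ≤ Real.sqrt (n + 1) * ‖f‖ * ‖Φ n‖ := by
      rw [hΨ, createFormal_succ]
      exact norm_createSector_apply_le f _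
    calc ‖Ψ (n + 1)‖ ^ 2 ≤ (Real.sqrt (n + 1) * ‖f‖ * ‖Φ n‖) ^ 2 := by gcongr
      _ = _ := by
          rw [mul_pow, mul_pow, Real.sq_sqrt (by positivity)]
          ring
  refine le_of_sq_le_sq ?_ (by positivity)
  rw [norm_sq_eq_tsum, hsum.tsum_eq_zero_add, h0, norm_zero, zero_pow two_ne_zero, zero_add,
    mul_pow, Real.sq_sqrt hS0, ← tsum_mul_right]
  have h1 : Summable fun n : ℕ => ‖Ψ (n + 1)‖ ^ 2 :=
    (summable_nat_add_iff (f := fun n => ‖Ψ n‖ ^ 2) 1).2 hsum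
  have h2 : Summable fun n : ℕ => ((n : ℝ) + 1) * ‖Φ n‖ ^ 2 * ‖f‖ ^ 2 :=
    (summable_of_mem_numberHalfDomain hΦ).mul_right (‖f‖ ^ 2)
  exact h1.tsum_le_tsum hn h2

/-- The vector `a*(f) Φ`. -/
def createVector {Φ : Fock μ D} (hΦ : Φ ∈ numberHalfDomain μ D) (f : Lp ℂ 2 μ) : Fock μ D :=
  ⟨createFormal D f (fun n => Φ n), memℓp_create f Φ hΦ⟩

theorem createVector_apply {Φ : Fock μ D} (hΦ : Φ ∈ numberHalfDomain μ D) (f : Lp ℂ 2 μ) (n : ℕ) :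
    createVector hΦ f n = createFormal D f (fun n => Φ n) n := rfl

/-- The map `f ↦ a*(f) Φ`. -/
def creationCLM {Φ : Fock μ D} (hΦ : Φ ∈ numberHalfDomain μ D) : Lp ℂ 2 μ →L[ℂ] Fock μ D :=
  LinearMap.mkContinuous
    { toFun := createVector hΦ
      map_add' := fun f g => Subtype.ext (createFormal_add f g _)
      map_smul' := fun c f => Subtype.ext (createFormal_smul c f _) }
    (Real.sqrt (∑' n : ℕ, ((n : ℝ) + 1) * ‖Φ n‖ ^ 2))
    fun f => norm_le_of_eq_createFormal hΦ (createVector_apply hΦ f)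

theorem creationCLM_apply {Φ : Fock μ D} (hΦ : Φ ∈ numberHalfDomain μ D) (f : Lp ℂ 2 μ) :
    creationCLM hΦ f = createVector hΦ f := rfl

theorem creationCLM_ofRapid (f : Lp ℂ 2 μ) (Ψ : rapid μ D) :
    creationCLM (ofRapid_mem_numberHalfDomain Ψ) f =
      ofRapid μ D ⟨createFormal D f Ψ, createFormal_mem_rapid f Ψ.2⟩ := rfl

variable {ι : Type*} (e : HilbertBasis ι ℂ (Lp ℂ 2 μ)) (B : Fin N → Matrix (Fin D) (Fin D) ℂ)
  (g : Fin N → Lp ℂ 2 μ)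

/-- Arbitrary functions `hs` are replaced by basis vectors one at a time. Creation operators
commute, so the head can be moved next to the basis part, which is why `ls` is generalized. -/
theorem testVector_mem_closure (v : EuclideanSpace ℂ (Fin D)) (hs : List (Lp ℂ 2 μ))
    (ls : List ι) : ofRapid μ D (testVector B g v (hs ++ ls.map e)) ∈
      (testDomain B g e).topologicalClosure := by
  induction hs generalizing ls with
  | nil =>
    refine Submodule.le_topologicalClosure _ ?_
    rw [testDomain_eq_span]
    exact Submodule.subset_span ⟨v, ls, rfl⟩
  | cons h hs ih =>
    set Φ := testVector B g v (hs ++ ls.map e) with hΦ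
    let L := creationCLM (ofRapid_mem_numberHalfDomain Φ)
    have hL : ∀ l, L (e l) = ofRapid μ D (testVector B g v (hs ++ (l :: ls).map e)) := by
      intro l
      refine (creationCLM_ofRapid (e l) Φ).trans ?_
      congr 1
      refine Subtype.ext ?_
      change createFormal D (e l) (createList D (hs ++ ls.map e) (dressedVacuum B g v)) =
        createList D (hs ++ e l :: ls.map e) (dressedVacuum B g v)
      exact (createList_append_cons _ _ _ _).symm
    -- The functions `f` with `a*(f) Φ` in the closure form a closed subspace containing every `e
    -- l`, hence everything.
    have hcl : (⊤ : Submodule ℂ (Lp ℂ 2 μ)) ≤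
        ((testDomain B g e).topologicalClosure).comap L.toLinearMap := by
      rw [← e.dense_span]
      refine Submodule.topologicalClosure_minimal _ (Submodule.span_le.2 ?_) ?_
      · rintro _ ⟨l, rfl⟩
        change L (e l) ∈ (testDomain B g e).topologicalClosure
        rw [hL]
        exact ih (l :: ls)
      · exact (Submodule.isClosed_topologicalClosure _).preimage L.continuous
    exact hcl (Submodule.mem_top (x := h))

/-- The span of the vectors `a*(h₁) ⋯ a*(hₙ) T (v ⊗ Ω)`, on sequences of components. -/
def dressedSpan : Submodule ℂ (FormalFock μ D) :=
  Submodule.span ℂ {Ψ | ∃ v hs, Ψ = createList D hs (dressedVacuum B g v)}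

theorem mem_closure_of_mem_dressedSpan {Ψ : FormalFock μ D} (hΨ : Ψ ∈ dressedSpan B g)
    (hr : Ψ ∈ rapid μ D) : ofRapid μ D ⟨Ψ, hr⟩ ∈ (testDomain B g e).topologicalClosure := by
  have hle : dressedSpan B g ≤
      ((testDomain B g e).topologicalClosure.comap (ofRapid μ D)).map (rapid μ D).subtype := by
    refine Submodule.span_le.2 ?_
    rintro _ ⟨v, hs, rfl⟩
    refine ⟨testVector B g v hs, ?_, rfl⟩
    have := testVector_mem_closure e B g v hs []
    rwa [List.map_nil, List.append_nil] at this
  obtain ⟨Φ, hΦ, rfl⟩ := hle hΨ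
  exact hΦ

theorem createFormal_mem_dressedSpan (h : Lp ℂ 2 μ) {Ψ : FormalFock μ D}
    (hΨ : Ψ ∈ dressedSpan B g) : createFormal D h Ψ ∈ dressedSpan B g := by
  have : dressedSpan B g ≤ (dressedSpan B g).comap (createFormal D h) := by
    refine Submodule.span_le.2 ?_
    rintro _ ⟨v, hs, rfl⟩
    exact Submodule.subset_span ⟨v, h :: hs, rfl⟩
  exact this hΨ

variable {B} in
theorem spinFormal_mem_dressedSpan {M : Matrix (Fin D) (Fin D) ℂ} (hM : ∀ j, Commute M (B j))
    {Ψ : FormalFock μ D} (hΨ : Ψ ∈ dressedSpan B g) : spinFormal μ M Ψ ∈ dressedSpan B g := by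
  have : dressedSpan B g ≤ (dressedSpan B g).comap (spinFormal μ M) := by
    refine Submodule.span_le.2 ?_
    rintro _ ⟨v, hs, rfl⟩
    refine Submodule.subset_span ⟨Matrix.toEuclideanCLM (n := Fin D) (𝕜 := ℂ) M v, hs, ?_⟩
    rw [spinFormal_createList, spinFormal_dressedVacuum hM]
  exact this hΨ

variable {B} in
theorem dressingGenerator_pow_mem_dressedSpan (hB : ∀ j j', Commute (B j) (B j'))
    {Ψ : FormalFock μ D} (hΨ : Ψ ∈ dressedSpan B g) (n : ℕ) :
    (dressingGenerator B g ^ n) Ψ ∈ dressedSpan B g := by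
  induction n with
  | zero => exact hΨ
  | succ n ih =>
    rw [pow_succ', Module.End.mul_apply, dressingGenerator_apply]
    exact Submodule.neg_mem _ (Submodule.sum_mem _ fun j _ =>
      spinFormal_mem_dressedSpan g (hB j) (createFormal_mem_dressedSpan B g _ ih))

theorem dressingGenerator_pow_apply_add (k : ℕ) {n : ℕ} {Ψ Φ : FormalFock μ D} {c : ℂ}
    (h : Ψ n = c • Φ n) : (dressingGenerator B g ^ k) Ψ (n + k) =
      c • (dressingGenerator B g ^ k) Φ (n + k) := by
  induction k with
  | zero => exact h
  | succ k ih =>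
    rw [pow_succ', Module.End.mul_apply, Module.End.mul_apply, ← add_assoc,
      dressingGenerator_apply_succ, dressingGenerator_apply_succ, ih]
    simp only [map_smul, smul_neg, Finset.smul_sum]

/-- Component `m` of `Gᵏ T (v ⊗ Ω)` sees only the term `G^(m-k) / (m-k)!` of the exponential, and `1
/ (k! (m-k)!)` is `m.choose k / m!`. -/
theorem dressingGenerator_pow_dressedVacuum_apply (v : EuclideanSpace ℂ (Fin D)) (k m : ℕ) :
    ((k.factorial : ℂ)⁻¹) • (dressingGenerator B g ^ k) (dressedVacuum B g v) m =
      (m.choose k : ℂ) • dressedVacuum B g v m := by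
  rcases lt_or_ge m k with h | h
  · rw [dressingGenerator_pow_apply_eq_zero B g _ k m h, Nat.choose_eq_zero_of_lt h]
    simp
  · obtain ⟨n, rfl⟩ : ∃ n, m = n + k := ⟨m - k, by omega⟩
    rw [dressingGenerator_pow_apply_add B g k (dressedVacuum_apply B g v n),
      ← Module.End.mul_apply, ← pow_add, add_comm k n, dressedVacuum_apply, smul_smul, smul_smul]
    congr 1
    have h1 : ((n + k).choose k : ℂ) * k.factorial * n.factorial = (n + k).factorial := by
      have := Nat.add_choose_mul_factorial_mul_factorial n k
      rw [← this]
      push_cast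
      ring
    have h2 : ∀ i : ℕ, (i.factorial : ℂ) ≠ 0 := fun i => by exact_mod_cast i.factorial_ne_zero
    rw [← h1]
    have h3 : ((n + k).choose k : ℂ) ≠ 0 := by
      exact_mod_cast (Nat.choose_pos (Nat.le_add_left k n)).ne'
    have := h2 k
    have := h2 n
    field_simp

/-- The partial sums of `exp (-G) T (v ⊗ Ω)`. -/
def undressing (v : EuclideanSpace ℂ (Fin D)) (M : ℕ) : FormalFock μ D :=
  ∑ k ∈ Finset.range (M + 1), ((-1 : ℂ) ^ k * ((k.factorial : ℂ)⁻¹)) •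
    (dressingGenerator B g ^ k) (dressedVacuum B g v)

theorem undressing_apply (v : EuclideanSpace ℂ (Fin D)) (M m : ℕ) :
    undressing B g v M m =
      (∑ k ∈ Finset.range (M + 1), (-1 : ℂ) ^ k * (m.choose k : ℂ)) • dressedVacuum B g v m := by
  rw [undressing, Finset.sum_apply, Finset.sum_smul]
  refine Finset.sum_congr rfl fun k _ => ?_
  rw [Pi.smul_apply, mul_smul, mul_smul, dressingGenerator_pow_dressedVacuum_apply]

theorem sum_range_choose_of_le (M m : ℕ) (h : m ≤ M) :
    ∑ k ∈ Finset.range (M + 1), (-1 : ℂ) ^ k * (m.choose k : ℂ) = if m = 0 then 1 else 0 := by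
  have h1 : ∑ k ∈ Finset.range (M + 1), (-1 : ℂ) ^ k * (m.choose k : ℂ) =
      ∑ k ∈ Finset.range (m + 1), (-1 : ℂ) ^ k * (m.choose k : ℂ) := by
    refine (Finset.sum_subset (Finset.range_mono (by omega)) fun k _ hk => ?_).symm
    rw [Nat.choose_eq_zero_of_lt (by simpa using hk), Nat.cast_zero, mul_zero]
  rw [h1]
  exact_mod_cast congrArg (Int.cast : ℤ → ℂ) (Int.alternating_sum_range_choose (n := m))

/-- The bound is independent of the cutoff `M`, as dominated convergence requires. -/
theorem norm_sum_range_choose_le (M m : ℕ) :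
    ‖∑ k ∈ Finset.range (M + 1), (-1 : ℂ) ^ k * (m.choose k : ℂ)‖ ≤ 2 ^ m := by
  have h : ∑ k ∈ Finset.range (M + 1), m.choose k ≤ 2 ^ m := by
    rw [← Nat.sum_range_choose]
    calc ∑ k ∈ Finset.range (M + 1), m.choose k
        ≤ ∑ k ∈ Finset.range (M + 1 + (m + 1)), m.choose k :=
          Finset.sum_le_sum_of_subset (Finset.range_mono (by omega))
      _ = ∑ k ∈ Finset.range (m + 1), m.choose k := by
          refine (Finset.sum_subset (Finset.range_mono (by omega)) fun k _ hk => ?_).symm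
          exact Nat.choose_eq_zero_of_lt (by simpa using hk)
  calc _ ≤ ∑ k ∈ Finset.range (M + 1), ‖(-1 : ℂ) ^ k * (m.choose k : ℂ)‖ := norm_sum_le _ _
    _ = ((∑ k ∈ Finset.range (M + 1), m.choose k : ℕ) : ℝ) := by
        push_cast
        exact Finset.sum_congr rfl fun k _ => by simp
    _ ≤ 2 ^ m := by exact_mod_cast h

theorem uniformlyRapid_undressing (v : EuclideanSpace ℂ (Fin D)) :
    UniformlyRapid (undressing B g v) := by
  intro r hr
  obtain ⟨C, hC⟩ := dressedVacuum_mem_rapid B g v (2 * r) (by positivity)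
  refine ⟨C, fun M m => ?_⟩
  rw [undressing_apply, norm_smul]
  calc _ ≤ r ^ m * (2 ^ m * ‖dressedVacuum B g v m‖) := by
        gcongr
        exact norm_sum_range_choose_le M m
    _ = (2 * r) ^ m * ‖dressedVacuum B g v m‖ := by rw [mul_pow]; ring
    _ ≤ C := hC () m

/-- The alternating binomial sum is complete once `m ≤ M` and vanishes for `m ≥ 1`: the formal
identity `exp (-G) exp G = 1`, sector by sector. -/
theorem undressing_apply_eq (v : EuclideanSpace ℂ (Fin D)) {M m : ℕ} (h : m ≤ M) :
    undressing B g v M m = vacuumFormal μ v m := by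
  rw [undressing_apply, sum_range_choose_of_le M m h]
  cases m with
  | zero => simp [dressedVacuum_apply]
  | succ m => simp [vacuumFormal_succ]

variable {B} in
theorem createList_vacuumFormal_mem_closure (hB : ∀ j j', Commute (B j) (B j'))
    (v : EuclideanSpace ℂ (Fin D)) (hs : List (Lp ℂ 2 μ)) :
    ofRapid μ D ⟨createList D hs (vacuumFormal μ v),
      createList_mem_rapid hs (vacuumFormal_mem_rapid v)⟩ ∈
      (testDomain B g e).topologicalClosure := by
  -- Uniform decay, membership in the span and eventual equality of each component all survive a
  -- creation operator, so one induction carries them from the vacuum to any product.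
  have key : UniformlyRapid (fun M => createList D hs (undressing B g v M)) ∧
      (∀ M, createList D hs (undressing B g v M) ∈ dressedSpan B g) ∧
      ∀ m, ∀ᶠ M in atTop, createList D hs (undressing B g v M) m =
        createList D hs (vacuumFormal μ v) m := by
    induction hs with
    | nil =>
      refine ⟨uniformlyRapid_undressing B g v, fun M => ?_, fun m => ?_⟩
      · change undressing B g v M ∈ dressedSpan B g
        refine (dressedSpan B g).sum_mem fun k _ => (dressedSpan B g).smul_mem _ ?_
        exact dressingGenerator_pow_mem_dressedSpan g hB (Submodule.subset_span ⟨v, [], rfl⟩) k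
      · filter_upwards [eventually_ge_atTop m] with M hM
        exact undressing_apply_eq B g v hM
    | cons h hs ih =>
      obtain ⟨h1, h2, h3⟩ := ih
      refine ⟨h1.createFormal h, fun M => createFormal_mem_dressedSpan B g h (h2 M), fun m => ?_⟩
      cases m with
      | zero => exact Eventually.of_forall fun M => rfl
      | succ m =>
        filter_upwards [h3 m] with M hM
        rw [createList_cons, createList_cons, createFormal_succ, createFormal_succ, hM]
  obtain ⟨h1, h2, h3⟩ := key
  refine (Submodule.isClosed_topologicalClosure _).mem_of_tendsto
    (h1.tendsto_ofRapid (createList_mem_rapid hs (vacuumFormal_mem_rapid v)) h3)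
    (Eventually.of_forall fun M => ?_)
  exact mem_closure_of_mem_dressedSpan e B g (h2 M) _

variable {B} in
-- A vector orthogonal to the test domain is orthogonal to every undressed product vector, each of
-- which lives in one sector. Hence all its components vanish.
theorem dense_testDomain (hB : ∀ j j', Commute (B j) (B j')) :
    Dense (testDomain B g e : Set (Fock μ D)) := by
  rw [Submodule.dense_iff_topologicalClosure_eq_top,
    ← Submodule.orthogonal_eq_bot_iff, Submodule.eq_bot_iff]
  intro Φ hΦ
  refine Subtype.ext (funext fun n => ?_)
  refine eq_zero_of_inner_productVector_eq_zero (Φ n) fun v f => ?_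
  have h1 := hΦ _ (createList_vacuumFormal_mem_closure e g hB v (List.ofFn f))
  have h2 : ofRapid μ D ⟨createList D (List.ofFn f) (vacuumFormal μ v),
      createList_mem_rapid _ (vacuumFormal_mem_rapid v)⟩ = lp.single 2 n (productVector μ v f) := by
    refine Subtype.ext (funext fun m => ?_)
    change createList D (List.ofFn f) (vacuumFormal μ v) m = _
    rw [createList_vacuumFormal]
    rfl
  rwa [h2, lp.inner_single_left] at h1

end TestVectors

/-! ### The displaced annihilation operators and their adjoints -/

section Displaced

variable {X : Type*} [MeasurableSpace X] {μ : Measure X} [SigmaFinite μ] {D N : ℕ}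

theorem inner_spin_left (M : Matrix (Fin D) (Fin D) ℂ) (Ψ Φ : Fock μ D) :
    ⟪spin μ M Ψ, Φ⟫_ℂ = ⟪Ψ, spin μ M.conjTranspose Φ⟫_ℂ := by
  rw [lp.inner_eq_tsum, lp.inner_eq_tsum]
  exact tsum_congr fun n => inner_spinSector_left M _ _

/-- The operator `â(h) = a(h) + ∑ⱼ ⟨h, gⱼ⟩ Bⱼ` on sequences of components. -/
def displacedFormal (B : Fin N → Matrix (Fin D) (Fin D) ℂ) (g : Fin N → Lp ℂ 2 μ) (h : Lp ℂ 2 μ) :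
    FormalFock μ D →ₗ[ℂ] FormalFock μ D :=
  annihilateFormal D h + shiftFormal B g h

theorem displacedFormal_createFormal (B : Fin N → Matrix (Fin D) (Fin D) ℂ)
    (g : Fin N → Lp ℂ 2 μ) (h f : Lp ℂ 2 μ) (Ψ : FormalFock μ D) :
    displacedFormal B g h (createFormal D f Ψ) =
      createFormal D f (displacedFormal B g h Ψ) + ⟪h, f⟫_ℂ • Ψ := by
  simp only [displacedFormal, LinearMap.add_apply, annihilateFormal_createFormal,
    shiftFormal_createFormal, map_add]
  abel

theorem displacedFormal_dressedVacuum {B : Fin N → Matrix (Fin D) (Fin D) ℂ}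
    (hB : ∀ j j', Commute (B j) (B j')) (g : Fin N → Lp ℂ 2 μ) (h : Lp ℂ 2 μ)
    (v : EuclideanSpace ℂ (Fin D)) : displacedFormal B g h (dressedVacuum B g v) = 0 := by
  rw [displacedFormal, LinearMap.add_apply, annihilateFormal_dressedVacuum hB, neg_add_cancel]

theorem coe_displaced (B : Fin N → Matrix (Fin D) (Fin D) ℂ) (g : Fin N → Lp ℂ 2 μ)
    (h : Lp ℂ 2 μ) (Ψ : (displaced B g h).domain) :
    (fun n => displaced B g h Ψ n) = displacedFormal B g h fun n => (Ψ : Fock μ D) n := by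
  have h1 : displaced B g h Ψ = (∑ j, ⟪h, g j⟫_ℂ • spin μ (B j) (Ψ : Fock μ D)) +
      annihilation D h Ψ :=
    (LinearPMap.vadd_apply (∑ j, ⟪h, g j⟫_ℂ • (spin μ (B j)).toLinearMap) (annihilation D h)
      Ψ).trans (by simp)
  funext n
  rw [h1, displacedFormal, LinearMap.add_apply, shiftFormal_apply, Pi.add_apply,
    Finset.sum_apply, add_comm, lp.coeFn_add, Pi.add_apply, lp.coeFn_sum, Finset.sum_apply]
  rfl

theorem mem_graph_displaced {B : Fin N → Matrix (Fin D) (Fin D) ℂ} {g : Fin N → Lp ℂ 2 μ}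
    {h : Lp ℂ 2 μ} {Ψ Φ : Fock μ D} : (Ψ, Φ) ∈ (displaced B g h).graph ↔
      Ψ ∈ numberHalfDomain μ D ∧ (fun n => Φ n) = displacedFormal B g h fun n => Ψ n := by
  rw [LinearPMap.mem_graph_iff]
  constructor
  · rintro ⟨χ, h1, h2⟩
    simp only at h1 h2
    subst h1 h2
    exact ⟨χ.2, coe_displaced B g h χ⟩
  · rintro ⟨h1, h2⟩
    exact ⟨⟨Ψ, h1⟩, rfl, Subtype.ext ((coe_displaced B g h ⟨Ψ, h1⟩).trans h2.symm)⟩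

theorem inner_annihilation (h : Lp ℂ 2 μ) {Ψ Ψ' Φ Φ' : Fock μ D}
    (hΨ : ∀ n, Ψ' n = annihilateFormal D h (fun n => Ψ n) n)
    (hΦ : ∀ n, Φ' n = createFormal D h (fun n => Φ n) n) : ⟪Ψ', Φ⟫_ℂ = ⟪Ψ, Φ'⟫_ℂ := by
  have h0 : Φ' 0 = 0 := hΦ 0
  have hs : Summable fun n => ⟪Ψ n, Φ' n⟫_ℂ := lp.summable_inner Ψ Φ'
  have hz := hs.tsum_eq_zero_add
  rw [h0, inner_zero_right, zero_add] at hz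
  rw [lp.inner_eq_tsum, lp.inner_eq_tsum, hz]
  refine tsum_congr fun n => ?_
  rw [hΨ, hΦ, annihilateFormal_apply, createFormal_succ, annihilateSector,
    ContinuousLinearMap.adjoint_inner_left]

/-- The map `h ↦ â(h)* Φ`. -/
def displacedAdjoint (B : Fin N → Matrix (Fin D) (Fin D) ℂ) (g : Fin N → Lp ℂ 2 μ)
    {Φ : Fock μ D} (hΦ : Φ ∈ numberHalfDomain μ D) : Lp ℂ 2 μ →L[ℂ] Fock μ D :=
  creationCLM hΦ + ∑ j, (innerSL ℂ (g j)).smulRight (spin μ (B j).conjTranspose Φ)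

theorem displacedAdjoint_apply (B : Fin N → Matrix (Fin D) (Fin D) ℂ) (g : Fin N → Lp ℂ 2 μ)
    {Φ : Fock μ D} (hΦ : Φ ∈ numberHalfDomain μ D) (h : Lp ℂ 2 μ) :
    displacedAdjoint B g hΦ h =
      createVector hΦ h + ∑ j, ⟪g j, h⟫_ℂ • spin μ (B j).conjTranspose Φ := by
  simp [displacedAdjoint, creationCLM_apply]

/-- Since `â(h)` is antilinear in `h`, its adjoint is linear in `h`; the coefficients `⟪h, g j⟫`
turn into `⟪g j, h⟫`. -/
theorem inner_displaced {B : Fin N → Matrix (Fin D) (Fin D) ℂ} {g : Fin N → Lp ℂ 2 μ}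
    {h : Lp ℂ 2 μ} {Ψ Ψ' Φ : Fock μ D} (hΨ : (Ψ, Ψ') ∈ (displaced B g h).graph)
    (hΦ : Φ ∈ numberHalfDomain μ D) : ⟪Ψ', Φ⟫_ℂ = ⟪Ψ, displacedAdjoint B g hΦ h⟫_ℂ := by
  obtain ⟨h1, h2⟩ := mem_graph_displaced.1 hΨ
  let A : Fock μ D := ⟨annihilateFormal D h (fun n => Ψ n), memℓp_annihilate h Ψ h1⟩
  have h3 : Ψ' = A + ∑ j, ⟪h, g j⟫_ℂ • spin μ (B j) Ψ := by
    refine Subtype.ext (h2.trans ?_)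
    funext n
    rw [displacedFormal, LinearMap.add_apply, shiftFormal_apply, Pi.add_apply, Finset.sum_apply,
      lp.coeFn_add, Pi.add_apply, lp.coeFn_sum, Finset.sum_apply]
    rfl
  rw [h3, displacedAdjoint_apply, inner_add_left, inner_add_right,
    inner_annihilation h (Ψ := Ψ) (Φ := Φ) (Φ' := createVector hΦ h) (fun _ => rfl) (fun _ => rfl),
    sum_inner, inner_sum]
  congr 1
  refine Finset.sum_congr rfl fun j _ => ?_
  rw [inner_smul_left, inner_smul_right, inner_conj_symm, inner_spin_left]

theorem mem_graph_adjoint_displaced {B : Fin N → Matrix (Fin D) (Fin D) ℂ}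
    {g : Fin N → Lp ℂ 2 μ} {h : Lp ℂ 2 μ} (hd : Dense (numberHalfDomain μ D : Set (Fock μ D)))
    {Φ : Fock μ D} (hΦ : Φ ∈ numberHalfDomain μ D) :
    (Φ, displacedAdjoint B g hΦ h) ∈ ((displaced B g h)†).graph := by
  rw [LinearPMap.adjoint_graph_eq_graph_adjoint hd, Submodule.mem_adjoint_iff]
  intro a b hab
  rw [inner_displaced hab hΦ, sub_self]

theorem displacedAdjoint_zero (B : Fin N → Matrix (Fin D) (Fin D) ℂ) (g : Fin N → Lp ℂ 2 μ)
    {Φ : Fock μ D} (hΦ : Φ ∈ numberHalfDomain μ D) (h0 : Φ = 0) (h : Lp ℂ 2 μ) :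
    displacedAdjoint B g hΦ h = 0 := by
  subst h0
  have h1 : createVector hΦ h = 0 := Subtype.ext (map_zero (createFormal D h))
  rw [displacedAdjoint_apply, h1]
  simp

variable {ι : Type*} (B : Fin N → Matrix (Fin D) (Fin D) ℂ) (g : Fin N → Lp ℂ 2 μ)
  (e : ι → Lp ℂ 2 μ)

/-- The span of the sequences of components of the dressed test vectors. -/
def testFormal : Submodule ℂ (FormalFock μ D) :=
  Submodule.span ℂ {Ψ | ∃ v ls, Ψ = createList D (List.map e ls) (dressedVacuum B g v)}

theorem testFormal_le_rapid : testFormal B g e ≤ rapid μ D := by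
  refine Submodule.span_le.2 ?_
  rintro _ ⟨v, ls, rfl⟩
  exact createList_mem_rapid _ (dressedVacuum_mem_rapid B g v)

theorem coe_mem_testFormal {Ψ : Fock μ D} (hΨ : Ψ ∈ testDomain B g e) :
    (fun n => Ψ n) ∈ testFormal B g e := by
  rw [testDomain_eq_span] at hΨ
  induction hΨ using Submodule.span_induction with
  | mem Ψ h =>
    obtain ⟨v, ls, rfl⟩ := h
    exact Submodule.subset_span ⟨v, ls, rfl⟩
  | zero => exact Submodule.zero_mem _
  | add Ψ Φ _ _ h1 h2 => exact Submodule.add_mem _ h1 h2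
  | smul c Ψ _ h => exact Submodule.smul_mem _ c h

theorem testDomain_le_numberHalfDomain : testDomain B g e ≤ numberHalfDomain μ D := by
  rw [testDomain_eq_span]
  refine Submodule.span_le.2 ?_
  rintro _ ⟨v, ls, rfl⟩
  exact ofRapid_mem_numberHalfDomain _

theorem createFormal_mem_testFormal (l : ι) {Ψ : FormalFock μ D} (hΨ : Ψ ∈ testFormal B g e) :
    createFormal D (e l) Ψ ∈ testFormal B g e := by
  have : testFormal B g e ≤ (testFormal B g e).comap (createFormal D (e l)) := by
    refine Submodule.span_le.2 ?_
    rintro _ ⟨v, ls, rfl⟩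
    exact Submodule.subset_span ⟨v, l :: ls, rfl⟩
  exact this hΨ

variable {B}

theorem displacedFormal_mem_testFormal (hB : ∀ j j', Commute (B j) (B j')) (h : Lp ℂ 2 μ)
    {Ψ : FormalFock μ D} (hΨ : Ψ ∈ testFormal B g e) :
    displacedFormal B g h Ψ ∈ testFormal B g e := by
  have : testFormal B g e ≤ (testFormal B g e).comap (displacedFormal B g h) := by
    refine Submodule.span_le.2 ?_
    rintro _ ⟨v, ls, rfl⟩
    change displacedFormal B g h _ ∈ testFormal B g e
    induction ls with
    | nil =>
      rw [List.map_nil, createList_nil, displacedFormal_dressedVacuum hB]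
      exact Submodule.zero_mem _
    | cons l ls ih =>
      rw [List.map_cons, createList_cons, displacedFormal_createFormal]
      exact Submodule.add_mem _ (createFormal_mem_testFormal B g e l ih)
        (Submodule.smul_mem _ _ (Submodule.subset_span ⟨v, ls, rfl⟩))
  exact this hΨ

variable {e}

/-- Commuting `â_ℓ` to the right produces only factors `⟪e l, e l'⟫` with `l'` in the list, all zero
by orthogonality, and finally `â_ℓ` meets the dressed vacuum. -/
theorem displacedFormal_createList_eq_zero (hB : ∀ j j', Commute (B j) (B j'))
    (he : Orthonormal ℂ e) (v : EuclideanSpace ℂ (Fin D)) {l : ι} {ls : List ι} (hl : l ∉ ls) :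
    displacedFormal B g (e l) (createList D (ls.map e) (dressedVacuum B g v)) = 0 := by
  induction ls with
  | nil => exact displacedFormal_dressedVacuum hB g _ v
  | cons l' ls ih =>
    rw [List.mem_cons, not_or] at hl
    rw [List.map_cons, createList_cons, displacedFormal_createFormal, ih hl.2, he.2 hl.1, map_zero,
      zero_smul, add_zero]

theorem finite_displacedFormal_ne_zero (hB : ∀ j j', Commute (B j) (B j')) (he : Orthonormal ℂ e)
    {Ψ : FormalFock μ D} (hΨ : Ψ ∈ testFormal B g e) :
    {l | displacedFormal B g (e l) Ψ ≠ 0}.Finite := by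
  induction hΨ using Submodule.span_induction with
  | mem Ψ h =>
    obtain ⟨v, ls, rfl⟩ := h
    refine (List.finite_toSet ls).subset fun l hl => ?_
    by_contra h
    exact hl (displacedFormal_createList_eq_zero g hB he v h)
  | zero => simp
  | add Ψ Φ _ _ h1 h2 =>
    refine (h1.union h2).subset fun l hl => ?_
    by_contra h
    simp only [Set.mem_union, Set.mem_ofPred_eq, not_or, not_not] at h
    exact hl (by rw [map_add, h.1, h.2, add_zero])
  | smul c Ψ _ h =>
    refine h.subset fun l hl h' => ?_
    exact hl (by rw [map_smul, h', smul_zero])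

end Displaced

/-! ### The renormalized operator: convergence, symmetry and lower bound -/

section Hamiltonian

/-- The case of no interaction, `N = 0`, of the density theorem: test vectors already lie in this
domain. -/
theorem dense_numberHalfDomain {X : Type*} [MeasurableSpace X] (μ : Measure X) [SigmaFinite μ]
    (D : ℕ) : Dense (numberHalfDomain μ D : Set (Fock μ D)) := by
  obtain ⟨w, b, -⟩ := exists_hilbertBasis ℂ (Lp ℂ 2 μ)
  exact (dense_testDomain (B := (Fin.elim0 : Fin 0 → Matrix (Fin D) (Fin D) ℂ)) b Fin.elim0
    fun j => j.elim0).mono (testDomain_le_numberHalfDomain _ _ _)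

variable {X : Type*} [MeasurableSpace X] {μ : Measure X} {ι : Type*}

/-- The matrix `⟨e_l, ω e_l'⟩` is the Gram matrix of the vectors `√ω e_l`. -/
theorem exists_inner_mulOp_eq_inner {ω : X → ℝ} (hω : Measurable ω) (h0 : ∀ᵐ x ∂μ, 0 ≤ ω x)
    {e : ι → Lp ℂ 2 μ} (he : ∀ l, e l ∈ (mulOp μ ω).domain) :
    ∃ y : ι → Lp ℂ 2 μ, ∀ l l', ⟪e l, mulOp μ ω ⟨e l', he l'⟩⟫_ℂ = ⟪y l, y l'⟫_ℂ := by
  have hmem : ∀ l, MemLp (fun x => ((Real.sqrt (ω x) : ℝ) : ℂ) * e l x) 2 μ := by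
    intro l
    have hm : AEStronglyMeasurable (fun x => ((Real.sqrt (ω x) : ℝ) : ℂ) * e l x) μ :=
      (Complex.measurable_ofReal.comp hω.sqrt).aestronglyMeasurable.mul
        (Lp.aestronglyMeasurable (e l))
    rw [memLp_two_iff_integrable_sq_norm hm]
    -- Pointwise `‖√ω e‖ ^ 2` is the modulus of the integrand of `⟪e, ω e⟫`, which is integrable
    -- because `e` and `ω e` are in `L²`.
    refine (L2.integrable_inner (𝕜 := ℂ) (e l) (mulOp μ ω ⟨e l, he l⟩)).norm.congr ?_
    have hop : mulOp μ ω ⟨e l, he l⟩ =ᵐ[μ] fun x => (ω x : ℂ) * e l x :=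
      (memLp_mul ⟨e l, he l⟩).coeFn_toLp
    filter_upwards [hop, h0] with x h1 h2
    rw [h1, RCLike.inner_apply, norm_mul, norm_mul, RCLike.norm_conj, norm_mul, mul_pow,
      Complex.norm_real, Complex.norm_real, Real.norm_of_nonneg h2,
      Real.norm_of_nonneg (Real.sqrt_nonneg _), Real.sq_sqrt h2]
    ring
  refine ⟨fun l => (hmem l).toLp, fun l l' => ?_⟩
  rw [L2.inner_def, L2.inner_def]
  refine integral_congr_ae ?_
  have hop : mulOp μ ω ⟨e l', he l'⟩ =ᵐ[μ] fun x => (ω x : ℂ) * e l' x :=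
    (memLp_mul ⟨e l', he l'⟩).coeFn_toLp
  filter_upwards [hop, h0, (hmem l).coeFn_toLp, (hmem l').coeFn_toLp] with x h1 h2 h3 h4
  have h5 : ((Real.sqrt (ω x) : ℝ) : ℂ) * ((Real.sqrt (ω x) : ℝ) : ℂ) = ω x := by
    rw [← Complex.ofReal_mul, Real.mul_self_sqrt h2]
  rw [h1, h3, h4, RCLike.inner_apply, RCLike.inner_apply, map_mul, Complex.conj_ofReal, ← h5]
  ring

open scoped ComplexOrder in
/-- Positivity of the sum over the entrywise product of two Gram matrices. -/
theorem re_sum_inner_mul_inner_nonneg {E F : Type*} [NormedAddCommGroup E] [InnerProductSpace ℂ E]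
    [NormedAddCommGroup F] [InnerProductSpace ℂ F] (s : Finset ι) (y : ι → E) (u : ι → F) :
    0 ≤ (∑ p ∈ s ×ˢ s, ⟪y p.1, y p.2⟫_ℂ * ⟪u p.1, u p.2⟫_ℂ).re := by
  -- Schur product theorem; the sum in question is the quadratic form of the Hadamard product at the
  -- all-ones vector.
  have h := ((Matrix.posSemidef_gram ℂ fun l : s => y l).hadamard
    (Matrix.posSemidef_gram ℂ fun l : s => u l)).dotProduct_mulVec_nonneg (fun _ => 1)
  have h1 : ∑ p ∈ s ×ˢ s, ⟪y p.1, y p.2⟫_ℂ * ⟪u p.1, u p.2⟫_ℂ =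
      ∑ l : s, ∑ l' : s, ⟪y l, y l'⟫_ℂ * ⟪u l, u l'⟫_ℂ := by
    rw [Finset.sum_product, ← Finset.sum_coe_sort s]
    exact Finset.sum_congr rfl fun l _ => (Finset.sum_coe_sort s _).symm
  rw [h1]
  have h2 := (Complex.le_def.1 h).1
  simpa [dotProduct, Matrix.mulVec] using h2

/-- Each row over a fixed `l'` is extended by zero to the product; a finite sum of unconditionally
convergent series is again one. -/
theorem hasSum_prod_of_finite_right {G κ : Type*} [AddCommMonoid G] [TopologicalSpace G]
    [ContinuousAdd G] {F : ι × κ → G} {s : Finset κ} (h0 : ∀ l, ∀ l' ∉ s, F (l, l') = 0)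
    {a : κ → G} (h : ∀ l', HasSum (fun l => F (l, l')) (a l')) : HasSum F (∑ l' ∈ s, a l') := by
  classical
  have h1 : ∀ l' ∈ s, HasSum (fun p : ι × κ => if p.2 = l' then F p else 0) (a l') := by
    intro l' _
    have hinj : Function.Injective fun l : ι => (l, l') := fun _ _ h => (Prod.mk.inj h).1
    refine (hinj.hasSum_iff ?_).1 ?_
    · rintro ⟨l, l''⟩ hl
      refine if_neg fun h => hl ⟨l, ?_⟩
      simp only at h
      rw [h]
    · simpa [Function.comp_def] using h l'
  refine (hasSum_sum h1).congr_fun ?_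
  rintro ⟨l, l'⟩
  by_cases hl' : l' ∈ s
  · simp [hl']
  · simp [h0 l l' hl']

variable [SigmaFinite μ] {D N : ℕ} {K : Matrix (Fin D) (Fin D) ℂ}
  {B : Fin N → Matrix (Fin D) (Fin D) ℂ} {g : Fin N → Lp ℂ 2 μ} {ω : X → ℝ}

section

variable {e : ι → Lp ℂ 2 μ} {he : ∀ l, e l ∈ (mulOp μ ω).domain}

theorem HasRenormalizedAction.unique {Ψ Φ Φ' : Fock μ D}
    (h : HasRenormalizedAction K B g ω e he Ψ Φ) (h' : HasRenormalizedAction K B g ω e he Ψ Φ') :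
    Φ = Φ' := by
  obtain ⟨u, w, hu, hw, S, hS, rfl⟩ := h
  obtain ⟨u', w', hu', hw', S', hS', rfl⟩ := h'
  have hu : u = u' := funext fun l => LinearPMap.mem_graph_snd_inj _ (hu l) (hu' l) rfl
  subst hu
  have hw : w = w' := funext fun l => funext fun l' =>
    LinearPMap.mem_graph_snd_inj _ (hw l l') (hw' l l') rfl
  subst hw
  rw [hS.unique hS']

theorem HasRenormalizedAction.add {Ψ Ψ' Φ Φ' : Fock μ D}
    (h : HasRenormalizedAction K B g ω e he Ψ Φ)
    (h' : HasRenormalizedAction K B g ω e he Ψ' Φ') :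
    HasRenormalizedAction K B g ω e he (Ψ + Ψ') (Φ + Φ') := by
  obtain ⟨u, w, hu, hw, S, hS, rfl⟩ := h
  obtain ⟨u', w', hu', hw', S', hS', rfl⟩ := h'
  refine ⟨fun l => u l + u' l, fun l l' => w l l' + w' l l',
    fun l => Submodule.add_mem _ (hu l) (hu' l),
    fun l l' => Submodule.add_mem _ (hw l l') (hw' l l'), S + S', ?_, ?_⟩
  · simpa only [smul_add] using hS.add hS'
  · rw [map_add]
    abel

theorem HasRenormalizedAction.smul {Ψ Φ : Fock μ D} (c : ℂ)
    (h : HasRenormalizedAction K B g ω e he Ψ Φ) :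
    HasRenormalizedAction K B g ω e he (c • Ψ) (c • Φ) := by
  obtain ⟨u, w, hu, hw, S, hS, rfl⟩ := h
  refine ⟨fun l => c • u l, fun l l' => c • w l l',
    fun l => Submodule.smul_mem _ c (hu l),
    fun l l' => Submodule.smul_mem _ c (hw l l'), c • S, ?_, ?_⟩
  · simpa only [smul_comm c] using hS.const_smul c
  · rw [map_smul, smul_add]

/-- The form of the renormalized operator. -/
theorem HasRenormalizedAction.hasSum_inner
    (hd : Dense (numberHalfDomain μ D : Set (Fock μ D))) {Ψ Φ Φ' : Fock μ D}
    (h : HasRenormalizedAction K B g ω e he Φ Φ') {uΨ uΦ : ι → Fock μ D}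
    (huΨ : ∀ l, (Ψ, uΨ l) ∈ (displaced B g (e l)).graph)
    (huΦ : ∀ l, (Φ, uΦ l) ∈ (displaced B g (e l)).graph) :
    HasSum (fun p : ι × ι => ⟪e p.1, mulOp μ ω ⟨e p.2, he p.2⟩⟫_ℂ * ⟪uΨ p.1, uΦ p.2⟫_ℂ)
      ⟪Ψ, Φ' - spin μ K Φ⟫_ℂ := by
  obtain ⟨u, w, hu, hw, S, hS, rfl⟩ := h
  have hu : u = uΦ := funext fun l => LinearPMap.mem_graph_snd_inj _ (hu l) (huΦ l) rfl
  subst hu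
  rw [add_sub_cancel_right]
  refine (hS.mapL (innerSL ℂ Ψ)).congr_fun fun p => ?_
  -- The adjoint `â_ℓ*` is moved to the other side of the inner product through the graph
  -- description of the adjoint.
  have h1 := hw p.1 p.2
  rw [LinearPMap.adjoint_graph_eq_graph_adjoint hd, Submodule.mem_adjoint_iff] at h1
  rw [map_smul, innerSL_apply_apply, smul_eq_mul, ← sub_eq_zero.1 (h1 _ _ (huΨ p.1))]

end

variable (e : HilbertBasis ι ℂ (Lp ℂ 2 μ)) (he : ∀ l, e l ∈ (mulOp μ ω).domain)

/-- The test domain is invariant under `â(h)`, so `â_ℓ Ψ` again decays rapidly and an adjoint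
`â_ℓ'*` may be applied to it. -/
theorem exists_displaced_graph (hB : ∀ j j', Commute (B j) (B j')) {Ψ : Fock μ D}
    (hΨ : Ψ ∈ testDomain B g e) : ∃ u : ι → Fock μ D,
      (∀ l, (Ψ, u l) ∈ (displaced B g (e l)).graph) ∧ (∀ l, u l ∈ numberHalfDomain μ D) ∧
      ∃ s : Finset ι, ∀ l ∉ s, u l = 0 := by
  have h1 := coe_mem_testFormal B g e hΨ
  have h2 : ∀ l, displacedFormal B g (e l) (fun n => Ψ n) ∈ rapid μ D := fun l =>
    testFormal_le_rapid B g e (displacedFormal_mem_testFormal g e hB (e l) h1)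
  have h3 := finite_displacedFormal_ne_zero g hB e.orthonormal h1
  refine ⟨fun l => ofRapid μ D ⟨_, h2 l⟩, fun l => ?_, fun l => ofRapid_mem_numberHalfDomain _,
    h3.toFinset, fun l hl => ?_⟩
  · exact mem_graph_displaced.2 ⟨testDomain_le_numberHalfDomain B g e hΨ, rfl⟩
  · rw [Set.Finite.mem_toFinset, Set.mem_ofPred_eq, not_not] at hl
    exact Subtype.ext hl

/-- For fixed `l'` the series over `l` is the image of the expansion of `ω e_l'` under `h ↦ â(h)* Φ`
with `Φ = â_l' Ψ`, so its sum is `â(ω e_l')* Φ`. Only finitely many `l'` give `Φ ≠ 0`. -/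
theorem exists_hasRenormalizedAction (K : Matrix (Fin D) (Fin D) ℂ)
    (hB : ∀ j j', Commute (B j) (B j')) {Ψ : Fock μ D} (hΨ : Ψ ∈ testDomain B g e) :
    ∃ Φ, HasRenormalizedAction K B g ω e he Ψ Φ := by
  obtain ⟨u, hu, hN, s, hs⟩ := exists_displaced_graph e hB hΨ
  have hd := dense_numberHalfDomain μ D
  have hsum : ∀ l', HasSum (fun l => ⟪e l, mulOp μ ω ⟨e l', he l'⟩⟫_ℂ •
      displacedAdjoint B g (hN l') (e l))
      (displacedAdjoint B g (hN l') (mulOp μ ω ⟨e l', he l'⟩)) := by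
    intro l'
    refine ((e.hasSum_repr (mulOp μ ω ⟨e l', he l'⟩)).mapL
      (displacedAdjoint B g (hN l'))).congr_fun fun l => ?_
    rw [map_smul, e.repr_apply_apply]
  exact ⟨_, u, fun l l' => displacedAdjoint B g (hN l') (e l), hu,
    fun l l' => mem_graph_adjoint_displaced hd (hN l'), _,
    hasSum_prod_of_finite_right (s := s)
      (fun l l' hl' => (congrArg _ (displacedAdjoint_zero B g (hN l') (hs l' hl') (e l))).trans
        (smul_zero _)) hsum, rfl⟩

/-- The renormalized operator on the span of the dressed test vectors. -/
def renormalized (K : Matrix (Fin D) (Fin D) ℂ) (hB : ∀ j j', Commute (B j) (B j')) :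
    Fock μ D →ₗ.[ℂ] Fock μ D where
  domain := testDomain B g e
  toFun :=
    { toFun := fun Ψ => (exists_hasRenormalizedAction e he K hB Ψ.2).choose
      map_add' := fun Ψ Φ => (exists_hasRenormalizedAction e he K hB (Ψ + Φ).2).choose_spec.unique
        ((exists_hasRenormalizedAction e he K hB Ψ.2).choose_spec.add
          (exists_hasRenormalizedAction e he K hB Φ.2).choose_spec)
      map_smul' := fun c Ψ =>
        (exists_hasRenormalizedAction e he K hB (c • Ψ).2).choose_spec.unique
          ((exists_hasRenormalizedAction e he K hB Ψ.2).choose_spec.smul c) }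

theorem hasRenormalizedAction_renormalized (K : Matrix (Fin D) (Fin D) ℂ)
    (hB : ∀ j j', Commute (B j) (B j')) (Ψ : (renormalized (g := g) e he K hB).domain) :
    HasRenormalizedAction K B g ω e he Ψ (renormalized e he K hB Ψ) :=
  (exists_hasRenormalizedAction e he K hB Ψ.2).choose_spec

theorem renormalized_isFormalAdjoint (hK : K.IsHermitian) (hB : ∀ j j', Commute (B j) (B j'))
    (hω : Measurable ω) (h0 : ∀ᵐ x ∂μ, 0 ≤ ω x) :
    (renormalized (g := g) e he K hB).IsFormalAdjoint (renormalized (g := g) e he K hB) := by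
  intro Ψ Φ
  obtain ⟨y, hy⟩ := exists_inner_mulOp_eq_inner hω h0 he
  have hd := dense_numberHalfDomain μ D
  obtain ⟨u, hu, -⟩ := exists_displaced_graph e hB Ψ.2
  obtain ⟨u', hu', -⟩ := exists_displaced_graph e hB Φ.2
  have h1 := (hasRenormalizedAction_renormalized e he K hB Φ).hasSum_inner hd hu hu'
  have h2 := (hasRenormalizedAction_renormalized e he K hB Ψ).hasSum_inner hd hu' hu
  -- Conjugating the series of `⟪Φ, (H - K) Ψ⟫` and exchanging the indices gives that of `⟪Ψ, (H -
  -- K) Φ⟫`, since a Gram matrix is Hermitian.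
  have h3 := (Equiv.prodComm ι ι).hasSum_iff.2 (Complex.hasSum_conj'.2 h2)
  have h4 := h1.unique (h3.congr_fun fun p => by
    simp only [Function.comp_apply, Equiv.prodComm_apply, Prod.fst_swap, Prod.snd_swap, map_mul,
      inner_conj_symm, hy])
  have h5 : ⟪spin μ K (Ψ : Fock μ D), (Φ : Fock μ D)⟫_ℂ =
      ⟪(Ψ : Fock μ D), spin μ K (Φ : Fock μ D)⟫_ℂ := by
    rw [inner_spin_left, hK.eq]
  rw [inner_conj_symm, inner_sub_left, inner_sub_right, h5] at h4
  exact (sub_left_injective h4).symm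

theorem renormalized_isBoundedBelowBy (K : Matrix (Fin D) (Fin D) ℂ)
    (hB : ∀ j j', Commute (B j) (B j')) (hω : Measurable ω) (h0 : ∀ᵐ x ∂μ, 0 ≤ ω x) :
    IsBoundedBelowBy (renormalized (g := g) e he K hB) (-‖spin μ K‖) := by
  intro Ψ
  obtain ⟨y, hy⟩ := exists_inner_mulOp_eq_inner hω h0 he
  have hd := dense_numberHalfDomain μ D
  obtain ⟨u, hu, -, s, hs⟩ := exists_displaced_graph e hB Ψ.2
  have h1 := (hasRenormalizedAction_renormalized e he K hB Ψ).hasSum_inner hd hu hu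
  -- In the form both indices are confined to the finite set `s`, so positivity concerns a finite
  -- matrix and no limit is needed.
  have h2 : HasSum (fun p : ι × ι => ⟪e p.1, mulOp μ ω ⟨e p.2, he p.2⟩⟫_ℂ * ⟪u p.1, u p.2⟫_ℂ)
      (∑ p ∈ s ×ˢ s, ⟪e p.1, mulOp μ ω ⟨e p.2, he p.2⟩⟫_ℂ * ⟪u p.1, u p.2⟫_ℂ) := by
    refine hasSum_sum_of_ne_finset_zero fun p hp => ?_
    rw [Finset.mem_product, not_and_or] at hp
    rcases hp with hp | hp
    · rw [hs _ hp, inner_zero_left, mul_zero]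
    · rw [hs _ hp, inner_zero_right, mul_zero]
  have h3 := re_sum_inner_mul_inner_nonneg s y u
  simp only [← hy] at h3
  rw [← h1.unique h2, inner_sub_right, Complex.sub_re] at h3
  have h4 : -(‖spin μ K‖ * ‖(Ψ : Fock μ D)‖ ^ 2) ≤
      (⟪(Ψ : Fock μ D), spin μ K (Ψ : Fock μ D)⟫_ℂ).re := by
    refine neg_le_of_abs_le ?_
    calc _ ≤ ‖⟪(Ψ : Fock μ D), spin μ K (Ψ : Fock μ D)⟫_ℂ‖ := Complex.abs_re_le_norm _
      _ ≤ ‖(Ψ : Fock μ D)‖ * ‖spin μ K (Ψ : Fock μ D)‖ := norm_inner_le_norm _ _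
      _ ≤ ‖(Ψ : Fock μ D)‖ * (‖spin μ K‖ * ‖(Ψ : Fock μ D)‖) := by
          gcongr
          exact (spin μ K).le_opNorm _
      _ = _ := by ring
  linarith

end Hamiltonian

end GSB

end

theorem theorem2p3 {X : Type*} [MeasurableSpace X] (μ : Measure X) [SigmaFinite μ] {D N : ℕ}
    (K : Matrix (Fin D) (Fin D) ℂ) (hK : K.IsHermitian)
    (B : Fin N → Matrix (Fin D) (Fin D) ℂ) (hB : ∀ j j', Commute (B j) (B j'))
    (ω : X → ℝ) (hω : Measurable ω) (m : ℝ) (hm : 0 < m) (hωm : ∀ᵐ x ∂μ, m ≤ ω x)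
    (f : Fin N → X → ℂ) (hf : ∀ j, Measurable (f j))
    (hfω : ∀ j, MemLp (fun x => f j x / (ω x : ℂ)) 2 μ)
    {ι : Type*} (e : HilbertBasis ι ℂ (Lp ℂ 2 μ)) (he : ∀ l, e l ∈ (GSB.mulOp μ ω).domain) :
    (∀ v : EuclideanSpace ℂ (Fin D), GSB.vacuum μ v ∈ (GSB.dressing B (GSB.ratio hfω)).domain) ∧
    (∀ (v : EuclideanSpace ℂ (Fin D)) (ls : List ι), ∃! Ψ, GSB.IsDressed B (GSB.ratio hfω) e v ls Ψ) ∧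
    Dense (GSB.testDomain B (GSB.ratio hfω) e : Set (GSB.Fock μ D)) ∧
    ∃ H : GSB.Fock μ D →ₗ.[ℂ] GSB.Fock μ D,
      H.domain = GSB.testDomain B (GSB.ratio hfω) e ∧
      (∀ Ψ : H.domain, GSB.HasRenormalizedAction K B (GSB.ratio hfω) ω e he Ψ (H Ψ)) ∧
      H.IsFormalAdjoint H ∧
      ∃ c : ℝ, GSB.IsBoundedBelowBy H c ∧
        ∃ F : GSB.Fock μ D →ₗ.[ℂ] GSB.Fock μ D,
          GSB.IsFriedrichsExtension H F ∧ H ≤ F ∧ IsSelfAdjoint F ∧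
          GSB.IsBoundedBelowBy F c := by
  have h0 : ∀ᵐ x ∂μ, 0 ≤ ω x := hωm.mono fun x hx => hm.le.trans hx
  have hd := GSB.dense_testDomain (D := D) e (GSB.ratio hfω) hB
  have hsym := GSB.renormalized_isFormalAdjoint (g := GSB.ratio hfω) e he hK hB hω h0
  have hbd := GSB.renormalized_isBoundedBelowBy (g := GSB.ratio hfω) e he K hB hω h0
  refine ⟨GSB.vacuum_mem_dressing_domain B _, fun v ls => ?_, hd,
    GSB.renormalized e he K hB, rfl, GSB.hasRenormalizedAction_renormalized e he K hB, hsym,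
    _, hbd, GSB.exists_isFriedrichsExtension hsym hd hbd⟩
  simp only [GSB.isDressed_iff]
  exact ⟨_, rfl, fun _ h => h⟩
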